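/- A prop is a strict symmetric monoidal category whose objects are the natural numbers, with $m\oplus n=m+n$ on objects; $\mathbf{PROP}$ is the category of props and identity-on-objects strict symmetric monoidal functors. Theorem. Let $\mathcal C$ be a prop that has pushouts and pullbacks, and let $(\mathcal E,\mathcal M)$ be a factorisation system in $\mathcal C$: $\mathcal E$ and $\mathcal M$ are subcategories containing all isomorphisms, every arrow factors as an arrow of $\mathcal E$ followed by an arrow of $\mathcal M$, and for any two such factorisations $f=e;m$, $f'=e';m'$ and arrows $u,v$ with $f;v=u;f'$ there is a unique $s$ with $e;s=u;e'$ and $s;m'=m;v$. Suppose that $\mathcal M$ is stable under pushout and consists of monomorphisms. Let $\mathcal A$ be a sub-prop of $\mathcal C$ which contains $\mathcal M$, is stable under pullback in $\mathcal C$, and is such that for every cospan $X\to Z\leftarrow Y$ in $\mathcal A$ the canonical map to $Z$ from the pushout (in $\mathcal C$) of its pullback (in $\mathcal C$) lies in $\mathcal M$. Suppose further that $\oplus$ preserves pushouts in $\mathcal C$ (the $\oplus$ of two pushout squares is a pushout square) and pullbacks in $\mathcal A$ (the $\oplus$ of two pullback squares of $\mathcal C$ over cospans with legs in $\mathcal A$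 is a pullback square of $\mathcal C$), and that $\mathcal M$ is closed under $\oplus$. Let $\mathrm{Cospan}(\mathcal C)$ be the prop whose arrows $X\to Y$ are isomorphism classes of cospans $X\to N\leftarrow Y$ in $\mathcal C$, composed by pushout; let $\mathrm{Span}(\mathcal A)$ be the prop whose arrows are isomorphism classes of spans in $\mathcal C$ with both legs in $\mathcal A$, composed by pullback in $\mathcal C$; let $\mathrm{Corel}(\mathcal C)$ be the prop whose arrows $X\to Y$ are cospans $X\to N\leftarrow Y$ in $\mathcal C$ modulo the equivalence relation generated by relating $X\to N\leftarrow Y$ to $X\to N'\leftarrow Y$ whenever some $m\colon N\to N'$ in $\mathcal M$ commutes with the legs, composed by pushout. In all three the monoidal product is componentwise. Let $\Gamma\colon\mathrm{Cospan}(\mathcal C)\to\mathrm{Corel}(\mathcal C)$ send the class of a cospan to the corelation it represents, and let $\Pi\colon\mathrm{Span}(\mathcal A)\to\mathrm{Corel}(\mathcal C)$ send the class of a span to the corelation represented by its pushout cospan in $\mathcal C$. Let $\mathcal A+\mathcal A^{\mathrm{op}}$ be the coproduct in $\mathbf{PROP}$, with the morphisms $\mathcal A+\mathcal A^{\mathrm{op}}\to\mathrm{Cospan}(\mathcal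 C)$ and $\mathcal A+\mathcal A^{\mathrm{op}}\to\mathrm{Span}(\mathcal A)$ induced by $$f\mapsto(\xrightarrow{f}\xleftarrow{\mathrm{id}}),\quad g\mapsto(\xrightarrow{\mathrm{id}}\xleftarrow{g})\qquad\text{and}\qquad f\mapsto(\xleftarrow{\mathrm{id}}\xrightarrow{f}),\quad g\mapsto(\xleftarrow{g}\xrightarrow{\mathrm{id}}).$$ Then the square $$\begin{array}{ccc}\mathcal A+\mathcal A^{\mathrm{op}}&\longrightarrow&\mathrm{Span}(\mathcal A)\\ \downarrow&&\downarrow{\scriptstyle\Pi}\\ \mathrm{Cospan}(\mathcal C)&\xrightarrow{\ \Gamma\ }&\mathrm{Corel}(\mathcal C)\end{array}$$ is a pushout in $\mathbf{PROP}$. -/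

import Mathlib

open CategoryTheory CategoryTheory.Limits
open scoped MonoidalCategory

universe v

/-- In a graph with vertex set `ℕ` and chosen loops `id`, the arrow `m ⟶ n` obtained from `id m`
by transport along an equality `m = n`. -/
def reindexId {Hom : ℕ → ℕ → Type v} (id : ∀ n, Hom n n) {m n : ℕ} (h : m = n) : Hom m n :=
  h ▸ id m

/-- A prop: a strict symmetric monoidal category whose objects are the natural numbers and whose
monoidal product is addition on objects. `comp` is written in diagrammatic order. The strict
associativity and unit laws equate arrows between equal (but not always definitionally equal)
natural numbers, so they are heterogeneous equalities. -/
structure PROP where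
  /-- the arrows `m ⟶ n` -/
  Hom : ℕ → ℕ → Type v
  /-- identities -/
  id : ∀ n, Hom n n
  /-- composition -/
  comp : ∀ {l m n}, Hom l m → Hom m n → Hom l n
  /-- the monoidal product on arrows -/
  tensor : ∀ {m n m' n'}, Hom m n → Hom m' n' → Hom (m + m') (n + n')
  /-- the symmetry -/
  swap : ∀ m n, Hom (m + n) (n + m)
  id_comp : ∀ {m n} (f : Hom m n), comp (id m) f = f
  comp_id : ∀ {m n} (f : Hom m n), comp f (id n) = f
  assoc : ∀ {k l m n} (f : Hom k l) (g : Hom l m) (h : Hom m n),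
    comp (comp f g) h = comp f (comp g h)
  tensor_id : ∀ m n, tensor (id m) (id n) = id (m + n)
  tensor_comp : ∀ {l m n l' m' n'} (f : Hom l m) (g : Hom m n) (f' : Hom l' m') (g' : Hom m' n'),
    tensor (comp f g) (comp f' g') = comp (tensor f f') (tensor g g')
  tensor_assoc : ∀ {m n m' n' m'' n''} (f : Hom m n) (g : Hom m' n') (h : Hom m'' n''),
    HEq (tensor (tensor f g) h) (tensor f (tensor g h))
  unit_tensor : ∀ {m n} (f : Hom m n), HEq (tensor (id 0) f) f
  tensor_unit : ∀ {m n} (f : Hom m n), HEq (tensor f (id 0)) f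
  swap_natural : ∀ {m n m' n'} (f : Hom m n) (g : Hom m' n'),
    comp (tensor f g) (swap n n') = comp (swap m m') (tensor g f)
  swap_swap : ∀ m n, comp (swap m n) (swap n m) = id (m + n)
  swap_add : ∀ m n k, HEq (swap m (n + k))
    (comp (comp (tensor (swap m n) (id k)) (reindexId id (Nat.add_assoc n m k)))
      (tensor (id n) (swap m k)))

namespace PROP

/-- The type of objects of a prop, that is `ℕ`. -/
def Obj (_ : PROP.{v}) : Type := ℕ

instance (P : PROP.{v}) : Category.{v} P.Obj where
  Hom m n := P.Hom m n
  id m := P.id m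
  comp f g := P.comp f g
  id_comp f := P.id_comp f
  comp_id f := P.comp_id f
  assoc f g h := P.assoc f g h

lemma reindexId_eq (P : PROP.{v}) {m n : P.Obj} (h : m = n) :
    (reindexId P.id h : P.Hom m n) = eqToHom h := by
  subst h; rfl

/-- The monoidal structure of a prop; its coherence isomorphisms are identities, up to the
identification of equal objects. -/
instance (P : PROP.{v}) : MonoidalCategoryStruct P.Obj where
  tensorObj := (fun m n => m + n : ℕ → ℕ → ℕ)
  tensorHom f g := P.tensor f g
  whiskerLeft m _ _ f := P.tensor (P.id m) f
  whiskerRight f m := P.tensor f (P.id m)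
  tensorUnit := (0 : ℕ)
  associator l m n := eqToIso (C := P.Obj) (Nat.add_assoc l m n)
  leftUnitor n := eqToIso (C := P.Obj) (Nat.zero_add n)
  rightUnitor n := eqToIso (C := P.Obj) (Nat.add_zero n)

section
open MonoidalCategory

lemma tensor_assoc_obj (P : PROP.{v}) (X Y Z : P.Obj) : (X ⊗ Y) ⊗ Z = X ⊗ (Y ⊗ Z) :=
  Nat.add_assoc X Y Z

lemma unit_tensor_obj (P : PROP.{v}) (X : P.Obj) : 𝟙_ P.Obj ⊗ X = X := Nat.zero_add X

lemma tensor_unit_obj (P : PROP.{v}) (X : P.Obj) : X ⊗ 𝟙_ P.Obj = X := Nat.add_zero X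

lemma associator_eq (P : PROP.{v}) (X Y Z : P.Obj) :
    α_ X Y Z = eqToIso (P.tensor_assoc_obj X Y Z) := rfl

lemma leftUnitor_eq (P : PROP.{v}) (X : P.Obj) : λ_ X = eqToIso (P.unit_tensor_obj X) := rfl

lemma rightUnitor_eq (P : PROP.{v}) (X : P.Obj) : ρ_ X = eqToIso (P.tensor_unit_obj X) := rfl

end

open MonoidalCategory in
lemma eqToHom_tensor_eqToHom (P : PROP.{v}) {m n m' n' : P.Obj} (h : m = n) (h' : m' = n') :
    (eqToHom h ⊗ₘ eqToHom h') = eqToHom (congrArg₂ (fun a b : P.Obj => a ⊗ b) h h') := by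
  subst h h'; exact P.tensor_id _ _

lemma naturality_of_heq {K : Type*} [Category K] {W X Y Z : K} {f : W ⟶ X} {g : Y ⟶ Z}
    (h : W = Y) (h' : X = Z) (e : HEq f g) : f ≫ eqToHom h' = eqToHom h ≫ g := by
  subst h h'; simp [eq_of_heq e]

instance (P : PROP.{v}) : MonoidalCategory P.Obj :=
  MonoidalCategory.ofTensorHom
    (id_tensorHom_id := fun m n => P.tensor_id m n)
    (id_tensorHom := fun _ _ _ _ => rfl)
    (tensorHom_id := fun _ _ => rfl)
    (tensorHom_comp_tensorHom := fun f₁ f₂ g₁ g₂ => (P.tensor_comp f₁ g₁ f₂ g₂).symm)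
    (associator_naturality := fun f g h => naturality_of_heq (P.tensor_assoc_obj _ _ _)
      (P.tensor_assoc_obj _ _ _) (P.tensor_assoc f g h))
    (leftUnitor_naturality := fun f => naturality_of_heq (P.unit_tensor_obj _) (P.unit_tensor_obj _)
      (P.unit_tensor f))
    (rightUnitor_naturality := fun f => naturality_of_heq (P.tensor_unit_obj _) (P.tensor_unit_obj _)
      (P.tensor_unit f))
    (pentagon := fun W X Y Z => by
      simp only [associator_eq, eqToIso.hom]
      rw [← eqToHom_refl Z rfl, ← eqToHom_refl W rfl]
      simp only [eqToHom_tensor_eqToHom, eqToHom_trans])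
    (triangle := fun X Y => by
      simp only [associator_eq, leftUnitor_eq, rightUnitor_eq, eqToIso.hom]
      rw [← eqToHom_refl X rfl, ← eqToHom_refl Y rfl]
      simp only [eqToHom_tensor_eqToHom, eqToHom_trans])

/-- The symmetry of a prop as an isomorphism. -/
def braidingIso (P : PROP.{v}) (X Y : P.Obj) :
    MonoidalCategory.tensorObj X Y ≅ MonoidalCategory.tensorObj Y X where
  hom := P.swap X Y
  inv := P.swap Y X
  hom_inv_id := P.swap_swap X Y
  inv_hom_id := P.swap_swap Y X

open MonoidalCategory in
lemma hexagon (P : PROP.{v}) (X Y Z : P.Obj) :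
    (α_ X Y Z).hom ≫ (P.braidingIso X (Y ⊗ Z)).hom ≫ (α_ Y Z X).hom =
      ((P.braidingIso X Y).hom ▷ Z) ≫ (α_ Y X Z).hom ≫ (Y ◁ (P.braidingIso X Z).hom) := by
  have h := P.swap_add X Y Z
  rw [reindexId_eq P (P.tensor_assoc_obj Y X Z)] at h
  have h' := naturality_of_heq (K := P.Obj) (P.tensor_assoc_obj X Y Z).symm
    (P.tensor_assoc_obj Y Z X) h
  rw [associator_eq, associator_eq, associator_eq]
  simp only [eqToIso.hom]
  refine (congrArg (fun t => eqToHom (P.tensor_assoc_obj X Y Z) ≫ t) h').trans ?_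
  rw [eqToHom_trans_assoc, eqToHom_refl, Category.id_comp]
  exact Category.assoc (obj := P.Obj) _ _ _

open MonoidalCategory in
instance (P : PROP.{v}) : SymmetricCategory P.Obj where
  braiding := P.braidingIso
  braiding_naturality_right X _ _ f := P.swap_natural (P.id X) f
  braiding_naturality_left f Z := P.swap_natural f (P.id Z)
  hexagon_forward := P.hexagon
  hexagon_reverse X Y Z := by
    have h := P.hexagon Z X Y
    rw [← cancel_epi ((P.braidingIso Z X).hom ▷ Y ≫ (α_ X Z Y).hom ≫ X ◁ (P.braidingIso Z Y).hom)]
    conv_lhs => rw [← h]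
    have e : ∀ U V : P.Obj, (P.braidingIso U V).hom ≫ (P.braidingIso V U).hom = 𝟙 _ :=
      fun U V => P.swap_swap U V
    have e1 : X ◁ (P.braidingIso Z Y).hom ≫ X ◁ (P.braidingIso Y Z).hom = 𝟙 _ := by
      rw [← MonoidalCategory.whiskerLeft_comp, e, MonoidalCategory.whiskerLeft_id]
    have e2 : (P.braidingIso Z X).hom ▷ Y ≫ (P.braidingIso X Z).hom ▷ Y = 𝟙 _ := by
      rw [← MonoidalCategory.comp_whiskerRight, e, MonoidalCategory.id_whiskerRight]
    simp only [Category.assoc, Iso.hom_inv_id_assoc, reassoc_of% e, reassoc_of% e1, e2,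
      Iso.hom_inv_id]
  symmetry m n := P.swap_swap m n

/-! ### The category of props -/

/-- A morphism of props: an identity-on-objects strict symmetric monoidal functor. -/
@[ext]
structure Morphism (P Q : PROP.{v}) where
  map : ∀ {m n}, P.Hom m n → Q.Hom m n
  map_id : ∀ n, map (P.id n) = Q.id n
  map_comp : ∀ {l m n} (f : P.Hom l m) (g : P.Hom m n), map (P.comp f g) = Q.comp (map f) (map g)
  map_tensor : ∀ {m n m' n'} (f : P.Hom m n) (g : P.Hom m' n'),
    map (P.tensor f g) = Q.tensor (map f) (map g)
  map_swap : ∀ m n, map (P.swap m n) = Q.swap m n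

/-- The category of props. -/
instance : Category PROP.{v} where
  Hom P Q := Morphism P Q
  id P := ⟨fun f => f, fun _ => rfl, fun _ _ => rfl, fun _ _ => rfl, fun _ _ => rfl⟩
  comp F G :=
    { map := fun f => G.map (F.map f)
      map_id := fun n => by rw [F.map_id, G.map_id]
      map_comp := fun f g => by rw [F.map_comp, G.map_comp]
      map_tensor := fun f g => by rw [F.map_tensor, G.map_tensor]
      map_swap := fun m n => by rw [F.map_swap, G.map_swap] }

lemma reindexId_op (P : PROP.{v}) {m n : P.Obj} (h : m = n) :
    (reindexId (Hom := fun a b => P.Hom b a) P.id h : P.Hom n m) = eqToHom h.symm := by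
  subst h; rfl

open MonoidalCategory in
lemma op_swap_add (P : PROP.{v}) (X Y Z : P.Obj) :
    HEq (β_ (Y ⊗ Z) X).hom
      (Y ◁ (β_ Z X).hom ≫ eqToHom (P.tensor_assoc_obj Y X Z).symm ≫ (β_ Y X).hom ▷ Z) := by
  have h := BraidedCategory.hexagon_reverse Y Z X
  rw [associator_eq, associator_eq, associator_eq] at h
  simp only [eqToIso.inv] at h
  rw [← h, HEq.comm]
  exact (eqToHom_comp_heq_iff _ _ _).2 ((comp_eqToHom_heq_iff _ _ _).2 HEq.rfl)

/-- The opposite prop. -/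
def op (P : PROP.{v}) : PROP.{v} where
  Hom m n := P.Hom n m
  id n := P.id n
  comp f g := P.comp g f
  tensor f g := P.tensor f g
  swap m n := P.swap n m
  id_comp f := P.comp_id f
  comp_id f := P.id_comp f
  assoc f g h := (P.assoc h g f).symm
  tensor_id := P.tensor_id
  tensor_comp f g f' g' := P.tensor_comp g f g' f'
  tensor_assoc f g h := P.tensor_assoc f g h
  unit_tensor f := P.unit_tensor f
  tensor_unit f := P.tensor_unit f
  swap_natural f g := (P.swap_natural g f).symm
  swap_swap m n := P.swap_swap m n
  swap_add m n k := by
    rw [reindexId_op P (P.tensor_assoc_obj n m k)]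
    exact P.op_swap_add m n k

/-- A sub-prop: a class of arrows containing the identities and the symmetries, and closed under
composition and monoidal product. -/
structure SubPROP (P : PROP.{v}) where
  arrows : MorphismProperty P.Obj
  id_mem : ∀ X : P.Obj, arrows (𝟙 X)
  comp_mem : ∀ {X Y Z : P.Obj} (f : X ⟶ Y) (g : Y ⟶ Z), arrows f → arrows g → arrows (f ≫ g)
  tensor_mem : ∀ {X Y X' Y' : P.Obj} (f : X ⟶ Y) (g : X' ⟶ Y'),
    arrows f → arrows g → arrows (f ⊗ₘ g)
  swap_mem : ∀ X Y : P.Obj, arrows (β_ X Y).hom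

namespace SubPROP

variable {P : PROP.{v}} (A : SubPROP P)

lemma subtype_heq {m n m' n' : P.Obj} (hm : m = m') (hn : n = n')
    (f : {f : m ⟶ n // A.arrows f}) (g : {f : m' ⟶ n' // A.arrows f}) (h : HEq f.1 g.1) :
    HEq f g := by
  subst hm hn
  exact heq_of_eq (Subtype.ext (eq_of_heq h))

/-- A sub-prop, regarded as a prop. -/
def toPROP : PROP.{v} where
  Hom := fun (m n : P.Obj) => {f : m ⟶ n // A.arrows f}
  id := fun (n : P.Obj) => ⟨𝟙 n, A.id_mem n⟩
  comp f g := ⟨f.1 ≫ g.1, A.comp_mem _ _ f.2 g.2⟩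
  tensor f g := ⟨f.1 ⊗ₘ g.1, A.tensor_mem _ _ f.2 g.2⟩
  swap := fun (m n : P.Obj) => ⟨(β_ m n).hom, A.swap_mem m n⟩
  id_comp f := Subtype.ext (Category.id_comp _)
  comp_id f := Subtype.ext (Category.comp_id _)
  assoc f g h := Subtype.ext (Category.assoc _ _ _)
  tensor_id m n := Subtype.ext (P.tensor_id m n)
  tensor_comp f g f' g' := Subtype.ext (P.tensor_comp _ _ _ _)
  tensor_assoc f g h := A.subtype_heq (P.tensor_assoc_obj _ _ _) (P.tensor_assoc_obj _ _ _) _ _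
    (P.tensor_assoc _ _ _)
  unit_tensor f := A.subtype_heq (P.unit_tensor_obj _) (P.unit_tensor_obj _) _ _ (P.unit_tensor _)
  tensor_unit f := A.subtype_heq (P.tensor_unit_obj _) (P.tensor_unit_obj _) _ _ (P.tensor_unit _)
  swap_natural f g := Subtype.ext (P.swap_natural _ _)
  swap_swap m n := Subtype.ext (P.swap_swap m n)
  swap_add m n k := by
    refine A.subtype_heq (P.tensor_assoc_obj _ _ _).symm (P.tensor_assoc_obj _ _ _) _ _
      ((P.swap_add m n k).trans (heq_of_eq ?_))
    have : ∀ {a b : P.Obj} (h : a = b),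
        (reindexId (Hom := fun (m n : P.Obj) => {f : m ⟶ n // A.arrows f})
          (fun (n : P.Obj) => ⟨𝟙 n, A.id_mem n⟩) h).1 = reindexId P.id h := by
      intro a b h; subst h; rfl
    have e := this (P.tensor_assoc_obj n m k)
    rw [← e]
    rfl

end SubPROP

/-! ### Coproducts of props -/

namespace Coprod

/-- Formal arrows built from the arrows of `P` and of `Q`. -/
inductive Term (P Q : PROP.{v}) : ℕ → ℕ → Type v
  | inl {m n} (f : P.Hom m n) : Term P Q m n
  | inr {m n} (f : Q.Hom m n) : Term P Q m n
  | comp {l m n} (s : Term P Q l m) (t : Term P Q m n) : Term P Q l n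
  | tensor {m n m' n'} (s : Term P Q m n) (t : Term P Q m' n') : Term P Q (m + m') (n + n')

variable {P Q : PROP.{v}}

/-- The value of a formal arrow in a prop `R` that receives morphisms from `P` and `Q`. -/
def eval {R : PROP.{v}} (F : P ⟶ R) (G : Q ⟶ R) : ∀ {m n}, Term P Q m n → R.Hom m n
  | _, _, .inl f => F.map f
  | _, _, .inr g => G.map g
  | _, _, .comp s t => R.comp (eval F G s) (eval F G t)
  | _, _, .tensor s t => R.tensor (eval F G s) (eval F G t)

/-- Two formal arrows are identified when they have the same value in every prop that receives
morphisms from `P` and `Q`. -/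
def Rel {m n} (s t : Term P Q m n) : Prop :=
  ∀ (R : PROP.{v}) (F : P ⟶ R) (G : Q ⟶ R), eval F G s = eval F G t

lemma mk_heq {m n m' n'} (hm : m = m') (hn : n = n') (s : Term P Q m n) (t : Term P Q m' n')
    (h : ∀ (R : PROP.{v}) (F : P ⟶ R) (G : Q ⟶ R), HEq (eval F G s) (eval F G t)) :
    HEq (Quot.mk Rel s) (Quot.mk Rel t) := by
  subst hm hn
  exact heq_of_eq (Quot.sound fun R F G => eq_of_heq (h R F G))

lemma reindexId_mk {m n : ℕ} (h : m = n) :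
    reindexId (Hom := fun m n => Quot (Rel (P := P) (Q := Q) (m := m) (n := n)))
      (fun n => Quot.mk _ (.inl (P.id n))) h = Quot.mk _ (.inl (reindexId P.id h)) := by
  subst h; rfl

lemma map_reindexId {R : PROP.{v}} (F : P ⟶ R) {m n : ℕ} (h : m = n) :
    F.map (reindexId P.id h) = reindexId R.id h := by
  subst h; exact F.map_id m

/-- The coproduct of two props. -/
def prop (P Q : PROP.{v}) : PROP.{v} where
  Hom m n := Quot (Rel (P := P) (Q := Q) (m := m) (n := n))
  id n := Quot.mk _ (.inl (P.id n))
  comp := Quot.map₂ Term.comp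
    (fun _ _ _ h R F G => by simp only [eval, h R F G])
    (fun _ _ _ h R F G => by simp only [eval, h R F G])
  tensor := Quot.map₂ Term.tensor
    (fun _ _ _ h R F G => by simp only [eval, h R F G])
    (fun _ _ _ h R F G => by simp only [eval, h R F G])
  swap m n := Quot.mk _ (.inl (P.swap m n))
  id_comp := by
    rintro m n ⟨f⟩
    exact Quot.sound fun R F G => by simp only [eval, F.map_id, R.id_comp]
  comp_id := by
    rintro m n ⟨f⟩
    exact Quot.sound fun R F G => by simp only [eval, F.map_id, R.comp_id]
  assoc := by
    rintro k l m n ⟨f⟩ ⟨g⟩ ⟨h⟩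
    exact Quot.sound fun R F G => by simp only [eval, R.assoc]
  tensor_id m n := Quot.sound fun R F G => by simp only [eval, F.map_id, R.tensor_id]
  tensor_comp := by
    rintro l m n l' m' n' ⟨f⟩ ⟨g⟩ ⟨f'⟩ ⟨g'⟩
    exact Quot.sound fun R F G => by simp only [eval, R.tensor_comp]
  tensor_assoc := by
    rintro m n m' n' m'' n'' ⟨f⟩ ⟨g⟩ ⟨h⟩
    exact mk_heq (Nat.add_assoc ..) (Nat.add_assoc ..) _ _ fun R F G => R.tensor_assoc _ _ _
  unit_tensor := by
    rintro m n ⟨f⟩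
    refine mk_heq (Nat.zero_add _) (Nat.zero_add _) _ _ fun R F G => ?_
    simp only [eval, F.map_id]
    exact R.unit_tensor _
  tensor_unit := by
    rintro m n ⟨f⟩
    refine mk_heq (Nat.add_zero _) (Nat.add_zero _) _ _ fun R F G => ?_
    simp only [eval, F.map_id]
    exact R.tensor_unit _
  swap_natural := by
    rintro m n m' n' ⟨f⟩ ⟨g⟩
    exact Quot.sound fun R F G => by simp only [eval, F.map_swap, R.swap_natural]
  swap_swap m n := Quot.sound fun R F G => by
    simp only [eval, F.map_swap, F.map_id, R.swap_swap]
  swap_add m n k := by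
    rw [reindexId_mk]
    refine mk_heq (Nat.add_assoc ..).symm (Nat.add_assoc ..) _ _ fun R F G => ?_
    simp only [eval, F.map_swap, F.map_id, map_reindexId]
    exact R.swap_add m n k

/-- The first coprojection. -/
def inl (P Q : PROP.{v}) : P ⟶ prop P Q where
  map f := Quot.mk _ (.inl f)
  map_id _ := rfl
  map_comp f g := Quot.sound fun R F G => by simp only [eval, F.map_comp]
  map_tensor f g := Quot.sound fun R F G => by simp only [eval, F.map_tensor]
  map_swap _ _ := rfl

/-- The second coprojection. -/
def inr (P Q : PROP.{v}) : Q ⟶ prop P Q where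
  map f := Quot.mk _ (.inr f)
  map_id _ := Quot.sound fun R F G => by simp only [eval, F.map_id, G.map_id]
  map_comp f g := Quot.sound fun R F G => by simp only [eval, G.map_comp]
  map_tensor f g := Quot.sound fun R F G => by simp only [eval, G.map_tensor]
  map_swap _ _ := Quot.sound fun R F G => by simp only [eval, F.map_swap, G.map_swap]

/-- The copairing. -/
def desc {R : PROP.{v}} (F : P ⟶ R) (G : Q ⟶ R) : prop P Q ⟶ R where
  map := Quot.lift (eval F G) fun _ _ h => h R F G
  map_id n := F.map_id n
  map_comp := by rintro l m n ⟨f⟩ ⟨g⟩; rfl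
  map_tensor := by rintro m n m' n' ⟨f⟩ ⟨g⟩; rfl
  map_swap m n := F.map_swap m n

lemma hom_eq_desc {R : PROP.{v}} (H : prop P Q ⟶ R) {m n} (t : Term P Q m n) :
    H.map (Quot.mk _ t) = eval (inl P Q ≫ H) (inr P Q ≫ H) t := by
  induction t with
  | inl f => rfl
  | inr f => rfl
  | comp s t hs ht => exact (H.map_comp (Quot.mk _ s) (Quot.mk _ t)).trans (by rw [hs, ht]; rfl)
  | tensor s t hs ht => exact (H.map_tensor (Quot.mk _ s) (Quot.mk _ t)).trans (by rw [hs, ht]; rfl)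

/-- `prop P Q` is a coproduct of `P` and `Q` in the category of props. -/
def isColimit (P Q : PROP.{v}) : IsColimit (BinaryCofan.mk (inl P Q) (inr P Q)) :=
  BinaryCofan.isColimitMk (fun s => desc s.inl s.inr) (fun _ => rfl) (fun _ => rfl) (by
    intro s H h₁ h₂
    apply Morphism.ext
    funext m n f
    induction f using Quot.ind with | mk t => ?_
    rw [hom_eq_desc, h₁, h₂]
    rfl)

end Coprod

instance : HasBinaryCoproducts PROP.{v} :=
  have : ∀ {P Q : PROP.{v}}, HasColimit (pair P Q) := fun {P Q} =>
    ⟨⟨⟨_, Coprod.isColimit P Q⟩⟩⟩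
  hasBinaryCoproducts_of_hasColimit_pair _


/-! ### Factorisation systems and compatibility with the monoidal product -/

/-- A factorisation system `(E, M)` in a category. -/
structure IsFactorisationSystem {K : Type*} [Category K] (E M : MorphismProperty K) : Prop where
  left_isMultiplicative : E.IsMultiplicative
  right_isMultiplicative : M.IsMultiplicative
  left_of_isIso : ∀ {X Y : K} (f : X ⟶ Y), IsIso f → E f
  right_of_isIso : ∀ {X Y : K} (f : X ⟶ Y), IsIso f → M f
  exists_factorisation : ∀ {X Y : K} (f : X ⟶ Y),
    ∃ (I : K) (e : X ⟶ I) (m : I ⟶ Y), E e ∧ M m ∧ e ≫ m = f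
  existsUnique_map : ∀ {X I Y X' I' Y' : K} (e : X ⟶ I) (m : I ⟶ Y) (e' : X' ⟶ I') (m' : I' ⟶ Y')
    (u : X ⟶ X') (v : Y ⟶ Y'), E e → M m → E e' → M m' → (e ≫ m) ≫ v = u ≫ e' ≫ m' →
      ∃! s : I ⟶ I', e ≫ s = u ≫ e' ∧ s ≫ m' = m ≫ v

/-- A factorisation system `(E, M)` with `M` stable under pushout. -/
structure IsCostableFactorisationSystem {K : Type*} [Category K] (E M : MorphismProperty K) : Prop
    extends IsFactorisationSystem E M where
  right_isStableUnderCobaseChange : M.IsStableUnderCobaseChange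

/-- A class of arrows of a prop is closed under the monoidal product. -/
def TensorClosed {C : PROP.{v}} (W : MorphismProperty C.Obj) : Prop :=
  ∀ ⦃X Y X' Y' : C.Obj⦄ (f : X ⟶ Y) (f' : X' ⟶ Y'), W f → W f' → W (f ⊗ₘ f')

/-- The monoidal product of two pushout squares of `C` is a pushout square. -/
def TensorPreservesPushouts (C : PROP.{v}) : Prop :=
  ∀ ⦃Z X Y P Z' X' Y' P' : C.Obj⦄
    (f : Z ⟶ X) (g : Z ⟶ Y) (i : X ⟶ P) (j : Y ⟶ P)
    (f' : Z' ⟶ X') (g' : Z' ⟶ Y') (i' : X' ⟶ P') (j' : Y' ⟶ P'),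
    IsPushout f g i j → IsPushout f' g' i' j' →
      IsPushout (f ⊗ₘ f') (g ⊗ₘ g') (i ⊗ₘ i') (j ⊗ₘ j')

/-- The monoidal product of two pullback squares of `C` over cospans with legs in `A` is a pullback
square of `C`. -/
def TensorPreservesPullbacks {C : PROP.{v}} (A : MorphismProperty C.Obj) : Prop :=
  ∀ ⦃Z X Y P Z' X' Y' P' : C.Obj⦄
    (p : P ⟶ X) (q : P ⟶ Y) (f : X ⟶ Z) (g : Y ⟶ Z)
    (p' : P' ⟶ X') (q' : P' ⟶ Y') (f' : X' ⟶ Z') (g' : Y' ⟶ Z'),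
    A f → A g → A f' → A g' → IsPullback p q f g → IsPullback p' q' f' g' →
      IsPullback (p ⊗ₘ p') (q ⊗ₘ q') (f ⊗ₘ f') (g ⊗ₘ g')

/-! ### Cospans and corelations -/

/-- A cospan `X ⟶ apex ⟵ Y`. -/
structure RawCospan {C : PROP.{v}} (X Y : C.Obj) : Type v where
  apex : C.Obj
  left : X ⟶ apex
  right : Y ⟶ apex

namespace RawCospan

variable {C : PROP.{v}}

/-- Two cospans are related by `W` if some arrow in `W` between their apexes commutes with the
legs. -/
def Rel (W : MorphismProperty C.Obj) {X Y : C.Obj} (s t : RawCospan X Y) : Prop :=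
  ∃ w : s.apex ⟶ t.apex, W w ∧ s.left ≫ w = t.left ∧ s.right ≫ w = t.right

/-- The composite of two cospans, by pushout. -/
noncomputable def comp [HasPushouts C.Obj] {X Y Z : C.Obj} (s : RawCospan X Y)
    (t : RawCospan Y Z) : RawCospan X Z :=
  ⟨pushout s.right t.left, s.left ≫ pushout.inl _ _, t.right ≫ pushout.inr _ _⟩

/-- The monoidal product of two cospans. -/
def tensor {X Y X' Y' : C.Obj} (s : RawCospan X Y) (t : RawCospan X' Y') :
    RawCospan (X ⊗ X') (Y ⊗ Y') :=
  ⟨s.apex ⊗ t.apex, s.left ⊗ₘ t.left, s.right ⊗ₘ t.right⟩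

/-- The cospan with left leg `f` and right leg the identity. -/
def ofHom {X Y : C.Obj} (f : X ⟶ Y) : RawCospan X Y := ⟨Y, f, 𝟙 Y⟩

/-- The cospan with left leg the identity and right leg `f`. -/
def ofOpHom {X Y : C.Obj} (f : Y ⟶ X) : RawCospan X Y := ⟨X, 𝟙 X, f⟩

/-- What is needed of `W` for cospans modulo `W` to form a prop. -/
structure Admissible (W : MorphismProperty C.Obj) : Prop where
  isMultiplicative : W.IsMultiplicative
  isStableUnderCobaseChange : W.IsStableUnderCobaseChange
  tensorClosed : TensorClosed W

lemma admissible_isomorphisms : Admissible (MorphismProperty.isomorphisms C.Obj) where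
  isMultiplicative := inferInstance
  isStableUnderCobaseChange := inferInstance
  tensorClosed := by
    intro X Y X' Y' f f' (_ : IsIso f) (_ : IsIso f')
    exact (inferInstance : IsIso (f ⊗ₘ f'))

variable {W : MorphismProperty C.Obj}

/-- Cospans modulo the equivalence relation generated by `W`. -/
abbrev Class (W : MorphismProperty C.Obj) (X Y : C.Obj) : Type v := Quot (Rel W (X := X) (Y := Y))

/-- The class of a cospan. -/
abbrev cls (W : MorphismProperty C.Obj) {X Y : C.Obj} (s : RawCospan X Y) : Class W X Y :=
  Quot.mk _ s

lemma cls_eq_of_iso (hW : Admissible W) {X Y : C.Obj} {s t : RawCospan X Y} (e : s.apex ≅ t.apex)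
    (h₁ : s.left ≫ e.hom = t.left) (h₂ : s.right ≫ e.hom = t.right) : cls W s = cls W t := by
  have := hW.isMultiplicative
  have := hW.isStableUnderCobaseChange
  exact Quot.sound ⟨e.hom, W.of_isIso e.hom, h₁, h₂⟩

lemma cls_comp_of_isPushout (hW : Admissible W) [HasPushouts C.Obj] {X Y Z P : C.Obj} (s : RawCospan X Y)
    (t : RawCospan Y Z) {i : s.apex ⟶ P} {j : t.apex ⟶ P} (h : IsPushout s.right t.left i j) :
    cls W (s.comp t) = cls W ⟨P, s.left ≫ i, t.right ≫ j⟩ :=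
  cls_eq_of_iso hW (s := s.comp t) (t := ⟨P, s.left ≫ i, t.right ≫ j⟩) h.isoPushout.symm
    (by simp [comp]) (by simp [comp])

lemma comp_rel_right (hW : Admissible W) [HasPushouts C.Obj] {X Y Z : C.Obj} (s : RawCospan X Y)
    {t t' : RawCospan Y Z} (h : Rel W t t') : Rel W (s.comp t) (s.comp t') := by
  obtain ⟨w, hw, h₁, h₂⟩ := h
  obtain ⟨P, l, r⟩ := t
  obtain ⟨P', l', r'⟩ := t'
  dsimp at w hw h₁ h₂
  subst h₁ h₂
  have sq : IsPushout w (pushout.inr s.right l) (pushout.inr s.right (l ≫ w))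
      ((IsPushout.of_hasPushout s.right l).desc (pushout.inl _ _) (w ≫ pushout.inr _ _)
        (by rw [pushout.condition, Category.assoc])) :=
    IsPushout.of_left
      (by simpa using (IsPushout.of_hasPushout s.right (l ≫ w)).flip) (by simp)
      (IsPushout.of_hasPushout s.right l).flip
  have := hW.isStableUnderCobaseChange
  exact ⟨_, W.of_isPushout sq.flip hw, by simp [comp], by simp [comp]⟩

lemma comp_rel_left (hW : Admissible W) [HasPushouts C.Obj] {X Y Z : C.Obj}
    {s s' : RawCospan X Y} (t : RawCospan Y Z) (h : Rel W s s') :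
    Rel W (s.comp t) (s'.comp t) := by
  obtain ⟨w, hw, h₁, h₂⟩ := h
  obtain ⟨P, l, r⟩ := s
  obtain ⟨P', l', r'⟩ := s'
  dsimp at w hw h₁ h₂
  subst h₁ h₂
  have sq : IsPushout w (pushout.inl r t.left) (pushout.inl (r ≫ w) t.left)
      ((IsPushout.of_hasPushout r t.left).desc (w ≫ pushout.inl _ _) (pushout.inr _ _)
        (by rw [← pushout.condition, Category.assoc])) :=
    IsPushout.of_left
      (by simpa using IsPushout.of_hasPushout (r ≫ w) t.left) (by simp)
      (IsPushout.of_hasPushout r t.left)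
  have := hW.isStableUnderCobaseChange
  exact ⟨_, W.of_isPushout sq.flip hw, by simp [comp], by simp [comp]⟩

lemma tensor_rel_right (hW : Admissible W) {X Y X' Y' : C.Obj} (s : RawCospan X Y) {t t' : RawCospan X' Y'}
    (h : Rel W t t') : Rel W (s.tensor t) (s.tensor t') := by
  obtain ⟨w, hw, h₁, h₂⟩ := h
  have := hW.isMultiplicative
  exact ⟨𝟙 _ ⊗ₘ w, hW.tensorClosed _ _ (W.id_mem _) hw, by
    simp only [tensor, MonoidalCategory.tensorHom_comp_tensorHom, Category.comp_id, h₁], by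
    simp only [tensor, MonoidalCategory.tensorHom_comp_tensorHom, Category.comp_id, h₂]⟩

lemma tensor_rel_left (hW : Admissible W) {X Y X' Y' : C.Obj} {s s' : RawCospan X Y} (t : RawCospan X' Y')
    (h : Rel W s s') : Rel W (s.tensor t) (s'.tensor t) := by
  obtain ⟨w, hw, h₁, h₂⟩ := h
  have := hW.isMultiplicative
  exact ⟨w ⊗ₘ 𝟙 _, hW.tensorClosed _ _ hw (W.id_mem _), by
    simp only [tensor, MonoidalCategory.tensorHom_comp_tensorHom, Category.comp_id, h₁], by
    simp only [tensor, MonoidalCategory.tensorHom_comp_tensorHom, Category.comp_id, h₂]⟩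

lemma cls_ofHom_comp (hW : Admissible W) [HasPushouts C.Obj] {X Y Z : C.Obj} (f : X ⟶ Y) (s : RawCospan Y Z) :
    cls W ((ofHom f).comp s) = cls W ⟨s.apex, f ≫ s.left, s.right⟩ := by
  rw [cls_comp_of_isPushout hW (ofHom f) s (i := s.left) (j := 𝟙 _) IsPushout.of_id_fst]
  simp [ofHom]

lemma cls_comp_ofOpHom (hW : Admissible W) [HasPushouts C.Obj] {X Y Z : C.Obj} (s : RawCospan X Y) (f : Z ⟶ Y) :
    cls W (s.comp (ofOpHom f)) = cls W ⟨s.apex, s.left, f ≫ s.right⟩ := by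
  rw [cls_comp_of_isPushout hW s (ofOpHom f) (i := 𝟙 _) (j := s.right) IsPushout.of_id_snd]
  simp [ofOpHom]

lemma cls_ofHom_of_iso (hW : Admissible W) {X Y : C.Obj} (f : X ≅ Y) :
    cls W (ofHom f.hom) = cls W (ofOpHom f.inv) :=
  cls_eq_of_iso hW (s := ofHom f.hom) (t := ofOpHom f.inv) f.symm (by simp [ofHom, ofOpHom])
    (by simp [ofHom, ofOpHom])

lemma cls_ofHom_comp_ofHom (hW : Admissible W) [HasPushouts C.Obj] {X Y Z : C.Obj} (f : X ⟶ Y) (g : Y ⟶ Z) :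
    cls W ((ofHom f).comp (ofHom g)) = cls W (ofHom (f ≫ g)) :=
  cls_ofHom_comp hW f (ofHom g)

lemma cls_ofOpHom_comp_ofOpHom (hW : Admissible W) [HasPushouts C.Obj] {X Y Z : C.Obj} (f : Y ⟶ X) (g : Z ⟶ Y) :
    cls W ((ofOpHom f).comp (ofOpHom g)) = cls W (ofOpHom (g ≫ f)) :=
  cls_comp_ofOpHom hW (ofOpHom f) g

lemma cls_comp_assoc (hW : Admissible W) [HasPushouts C.Obj] {X Y Z T : C.Obj} (s : RawCospan X Y) (t : RawCospan Y Z)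
    (u : RawCospan Z T) : cls W ((s.comp t).comp u) = cls W (s.comp (t.comp u)) := by
  have h₁ := IsPushout.of_hasPushout s.right t.left
  have h₂ := IsPushout.of_hasPushout t.right u.left
  have h₃ := IsPushout.of_hasPushout (pushout.inr s.right t.left) (pushout.inl t.right u.left)
  rw [cls_comp_of_isPushout hW (s.comp t) u (h₂.flip.paste_vert h₃.flip).flip,
    cls_comp_of_isPushout hW s (t.comp u) (h₁.paste_vert h₃)]
  simp [comp]

lemma ofHom_tensor_ofHom {X Y X' Y' : C.Obj} (f : X ⟶ Y) (g : X' ⟶ Y') :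
    (ofHom f).tensor (ofHom g) = ofHom (f ⊗ₘ g) := by
  simp [ofHom, tensor]

lemma ofOpHom_tensor_ofOpHom {X Y X' Y' : C.Obj} (f : Y ⟶ X) (g : Y' ⟶ X') :
    (ofOpHom f).tensor (ofOpHom g) = ofOpHom (f ⊗ₘ g) := by
  simp [ofOpHom, tensor]

lemma cls_heq {X Y X' Y' : C.Obj} (hX : X = X') (hY : Y = Y') (s : RawCospan X Y)
    (t : RawCospan X' Y') (h : s.apex = t.apex) (h₁ : HEq s.left t.left)
    (h₂ : HEq s.right t.right) : HEq (cls W s) (cls W t) := by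
  subst hX hY
  obtain ⟨P, l, r⟩ := s
  obtain ⟨P', l', r'⟩ := t
  dsimp at h
  subst h
  obtain rfl : l = l' := eq_of_heq h₁
  obtain rfl : r = r' := eq_of_heq h₂
  rfl

lemma cls_ofHom_heq {X Y X' Y' : C.Obj} (hX : X = X') (hY : Y = Y') (f : X ⟶ Y)
    (g : X' ⟶ Y') (h : HEq f g) : HEq (cls W (ofHom f)) (cls W (ofHom g)) := by
  subst hX hY
  rw [eq_of_heq h]

lemma reindexId_cls {X Y : C.Obj} (h : X = Y) :
    reindexId (Hom := fun (m n : C.Obj) => Class W m n) (fun (n : C.Obj) => cls W (ofHom (𝟙 n))) h =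
      cls W (ofHom (eqToHom h)) := by
  subst h; rfl

/-- Composition of classes of cospans. -/
noncomputable def Class.comp [HasPushouts C.Obj] (hW : Admissible W) {X Y Z : C.Obj} :
    Class W X Y → Class W Y Z → Class W X Z :=
  Quot.map₂ RawCospan.comp (fun s _ _ h => comp_rel_right hW s h)
    (fun _ _ t h => comp_rel_left hW t h)

/-- Monoidal product of classes of cospans. -/
def Class.tensor (hW : Admissible W) {X Y X' Y' : C.Obj} :
    Class W X Y → Class W X' Y' → Class W (X ⊗ X') (Y ⊗ Y') :=
  Quot.map₂ RawCospan.tensor (fun s _ _ h => tensor_rel_right hW s h)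
    (fun _ _ t h => tensor_rel_left hW t h)

lemma comp_ofHom_ofHom [HasPushouts C.Obj] (hW : Admissible W) {X Y Z : C.Obj} (f : X ⟶ Y)
    (g : Y ⟶ Z) :
    Class.comp hW (cls W (ofHom f)) (cls W (ofHom g)) = cls W (ofHom (f ≫ g)) :=
  cls_ofHom_comp_ofHom hW f g

lemma comp_ofOpHom_ofOpHom [HasPushouts C.Obj] (hW : Admissible W) {X Y Z : C.Obj} (f : Y ⟶ X)
    (g : Z ⟶ Y) :
    Class.comp hW (cls W (ofOpHom f)) (cls W (ofOpHom g)) = cls W (ofOpHom (g ≫ f)) :=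
  cls_ofOpHom_comp_ofOpHom hW f g

lemma tensor_ofHom_ofHom (hW : Admissible W) {X Y X' Y' : C.Obj} (f : X ⟶ Y) (g : X' ⟶ Y') :
    Class.tensor hW (cls W (ofHom f)) (cls W (ofHom g)) = cls W (ofHom (f ⊗ₘ g)) :=
  congrArg (cls W) (ofHom_tensor_ofHom f g)

lemma tensor_ofOpHom_ofOpHom (hW : Admissible W) {X Y X' Y' : C.Obj} (f : Y ⟶ X) (g : Y' ⟶ X') :
    Class.tensor hW (cls W (ofOpHom f)) (cls W (ofOpHom g)) = cls W (ofOpHom (f ⊗ₘ g)) :=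
  congrArg (cls W) (ofOpHom_tensor_ofOpHom f g)

lemma id_comp [HasPushouts C.Obj] (hW : Admissible W) {X Y : C.Obj} (s : RawCospan X Y) :
    cls W ((ofHom (𝟙 X)).comp s) = cls W s := by
  rw [cls_ofHom_comp hW, Category.id_comp]

lemma comp_id [HasPushouts C.Obj] (hW : Admissible W) {X Y : C.Obj} (s : RawCospan X Y) :
    cls W (s.comp (ofHom (𝟙 Y))) = cls W s := by
  refine (cls_comp_ofOpHom hW s (𝟙 Y)).trans ?_
  rw [Category.id_comp]

lemma comp_tensor [HasPushouts C.Obj] (hC : TensorPreservesPushouts C) (hW : Admissible W)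
    {X Y Z X' Y' Z' : C.Obj} (s : RawCospan X Y) (t : RawCospan Y Z) (s' : RawCospan X' Y')
    (t' : RawCospan Y' Z') :
    cls W ((s.comp t).tensor (s'.comp t')) = cls W ((s.tensor s').comp (t.tensor t')) := by
  rw [cls_comp_of_isPushout hW (s.tensor s') (t.tensor t')
    (hC _ _ _ _ _ _ _ _ (IsPushout.of_hasPushout s.right t.left)
      (IsPushout.of_hasPushout s'.right t'.left))]
  simp [comp, tensor]

lemma comp_swap [HasPushouts C.Obj] (hW : Admissible W) {X Y X' Y' : C.Obj}
    (s : RawCospan X Y) (t : RawCospan X' Y') :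
    Class.comp hW (cls W (s.tensor t)) (cls W (ofHom (β_ Y Y').hom)) =
      Class.comp hW (cls W (ofHom (β_ X X').hom)) (cls W (t.tensor s)) := by
  rw [cls_ofHom_of_iso hW (β_ Y Y')]
  refine (cls_comp_ofOpHom hW (s.tensor t) _).trans ?_
  refine Eq.trans ?_ (cls_ofHom_comp hW _ (t.tensor s)).symm
  exact cls_eq_of_iso hW (β_ s.apex t.apex) (by simp [tensor]) (by simp [tensor])

lemma swap_add [HasPushouts C.Obj] (hW : Admissible W) (X Y Z : C.Obj) :
    HEq (cls W (ofHom (β_ X (Y ⊗ Z)).hom))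
      (Class.comp hW (Class.comp hW
        (Class.tensor hW (cls W (ofHom (β_ X Y).hom)) (cls W (ofHom (𝟙 Z))))
        (cls W (ofHom (eqToHom (C.tensor_assoc_obj Y X Z)))))
        (Class.tensor hW (cls W (ofHom (𝟙 Y))) (cls W (ofHom (β_ X Z).hom)))) := by
  rw [tensor_ofHom_ofHom, tensor_ofHom_ofHom, comp_ofHom_ofHom, comp_ofHom_ofHom]
  refine cls_ofHom_heq (C.tensor_assoc_obj X Y Z).symm (C.tensor_assoc_obj Y Z X) _ _
    ((C.swap_add X Y Z).trans (heq_of_eq ?_))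
  rw [← C.reindexId_eq]
  rfl

/-- The prop of cospans in `C` modulo `W`. -/
noncomputable def prop (C : PROP.{v}) [HasPushouts C.Obj] (hC : TensorPreservesPushouts C)
    (W : MorphismProperty C.Obj) (hW : Admissible W) : PROP.{v} where
  Hom := fun (m n : C.Obj) => Class W m n
  id := fun (n : C.Obj) => cls W (ofHom (𝟙 n))
  comp := Class.comp hW
  tensor := Class.tensor hW
  swap := fun (m n : C.Obj) => cls W (ofHom (β_ m n).hom)
  id_comp := by
    rintro m n ⟨s⟩
    exact id_comp hW s
  comp_id := by
    rintro m n ⟨s⟩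
    exact comp_id hW s
  assoc := by
    rintro k l m n ⟨s⟩ ⟨t⟩ ⟨u⟩
    exact cls_comp_assoc hW s t u
  tensor_id := fun (m n : C.Obj) =>
    (tensor_ofHom_ofHom hW (𝟙 m) (𝟙 n)).trans
      (congrArg (fun f => cls W (ofHom f)) (MonoidalCategory.id_tensorHom_id m n))
  tensor_comp := by
    rintro l m n l' m' n' ⟨s⟩ ⟨t⟩ ⟨s'⟩ ⟨t'⟩
    exact comp_tensor hC hW s t s' t'
  tensor_assoc := by
    rintro m n m' n' m'' n'' ⟨s⟩ ⟨t⟩ ⟨u⟩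
    exact cls_heq (C.tensor_assoc_obj _ _ _) (C.tensor_assoc_obj _ _ _) ((s.tensor t).tensor u)
      (s.tensor (t.tensor u)) (C.tensor_assoc_obj _ _ _) (C.tensor_assoc _ _ _)
      (C.tensor_assoc _ _ _)
  unit_tensor := by
    rintro m n ⟨s⟩
    exact cls_heq (C.unit_tensor_obj _) (C.unit_tensor_obj _) ((ofHom (𝟙 (𝟙_ C.Obj))).tensor s) s
      (C.unit_tensor_obj _) (C.unit_tensor _) (C.unit_tensor _)
  tensor_unit := by
    rintro m n ⟨s⟩
    exact cls_heq (C.tensor_unit_obj _) (C.tensor_unit_obj _) (s.tensor (ofHom (𝟙 (𝟙_ C.Obj)))) s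
      (C.tensor_unit_obj _) (C.tensor_unit _) (C.tensor_unit _)
  swap_natural := by
    rintro m n m' n' ⟨s⟩ ⟨t⟩
    exact comp_swap hW s t
  swap_swap := fun (m n : C.Obj) =>
    (comp_ofHom_ofHom hW (β_ m n).hom (β_ n m).hom).trans
      (congrArg (fun f => cls W (ofHom f)) (SymmetricCategory.symmetry m n))
  swap_add m n k := by
    rw [reindexId_cls (C.tensor_assoc_obj n m k)]
    exact swap_add hW m n k

end RawCospan

/-! ### Spans -/

/-- A span `X ⟵ apex ⟶ Y` with both legs in the sub-prop `A`. -/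
structure RawSpan {C : PROP.{v}} (A : SubPROP C) (X Y : C.Obj) : Type v where
  apex : C.Obj
  left : apex ⟶ X
  right : apex ⟶ Y
  left_mem : A.arrows left
  right_mem : A.arrows right

namespace RawSpan

variable {C : PROP.{v}} {A : SubPROP C}

/-- Isomorphism of spans. -/
def Rel {X Y : C.Obj} (s t : RawSpan A X Y) : Prop :=
  ∃ e : s.apex ≅ t.apex, e.hom ≫ t.left = s.left ∧ e.hom ≫ t.right = s.right

/-- The composite of two spans, by pullback in `C`. -/
noncomputable def comp [HasPullbacks C.Obj] (hA : A.arrows.IsStableUnderBaseChange) {X Y Z : C.Obj}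
    (s : RawSpan A X Y) (t : RawSpan A Y Z) : RawSpan A X Z where
  apex := pullback s.right t.left
  left := pullback.fst _ _ ≫ s.left
  right := pullback.snd _ _ ≫ t.right
  left_mem := A.comp_mem _ _
    (A.arrows.of_isPullback (IsPullback.of_hasPullback s.right t.left).flip t.left_mem) s.left_mem
  right_mem := A.comp_mem _ _
    (A.arrows.of_isPullback (IsPullback.of_hasPullback s.right t.left) s.right_mem) t.right_mem

/-- The monoidal product of two spans. -/
def tensor {X Y X' Y' : C.Obj} (s : RawSpan A X Y) (t : RawSpan A X' Y') :
    RawSpan A (X ⊗ X') (Y ⊗ Y') :=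
  ⟨s.apex ⊗ t.apex, s.left ⊗ₘ t.left, s.right ⊗ₘ t.right, A.tensor_mem _ _ s.left_mem t.left_mem,
    A.tensor_mem _ _ s.right_mem t.right_mem⟩

/-- The span with left leg the identity and right leg `f`. -/
def ofHom {X Y : C.Obj} (f : X ⟶ Y) (hf : A.arrows f) : RawSpan A X Y :=
  ⟨X, 𝟙 X, f, A.id_mem X, hf⟩

/-- The span with left leg `f` and right leg the identity. -/
def ofOpHom {X Y : C.Obj} (f : Y ⟶ X) (hf : A.arrows f) : RawSpan A X Y :=
  ⟨Y, f, 𝟙 Y, hf, A.id_mem Y⟩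

/-- Isomorphism classes of spans. -/
abbrev Class (A : SubPROP C) (X Y : C.Obj) : Type v := Quot (Rel (A := A) (X := X) (Y := Y))

/-- The class of a span. -/
abbrev cls {X Y : C.Obj} (s : RawSpan A X Y) : Class A X Y := Quot.mk _ s

lemma cls_eq_of_iso {X Y : C.Obj} {s t : RawSpan A X Y} (e : s.apex ≅ t.apex)
    (h₁ : e.hom ≫ t.left = s.left) (h₂ : e.hom ≫ t.right = s.right) : cls s = cls t :=
  Quot.sound ⟨e, h₁, h₂⟩

lemma tensor_rel_right {X Y X' Y' : C.Obj} (s : RawSpan A X Y) {t t' : RawSpan A X' Y'}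
    (h : Rel t t') : Rel (s.tensor t) (s.tensor t') := by
  obtain ⟨e, h₁, h₂⟩ := h
  refine ⟨MonoidalCategory.tensorIso (Iso.refl _) e, ?_, ?_⟩
  · simp only [tensor, MonoidalCategory.tensorIso_hom, MonoidalCategory.tensorHom_comp_tensorHom,
      Iso.refl_hom, Category.id_comp, h₁]
  · simp only [tensor, MonoidalCategory.tensorIso_hom, MonoidalCategory.tensorHom_comp_tensorHom,
      Iso.refl_hom, Category.id_comp, h₂]

lemma tensor_rel_left {X Y X' Y' : C.Obj} {s s' : RawSpan A X Y} (t : RawSpan A X' Y')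
    (h : Rel s s') : Rel (s.tensor t) (s'.tensor t) := by
  obtain ⟨e, h₁, h₂⟩ := h
  refine ⟨MonoidalCategory.tensorIso e (Iso.refl _), ?_, ?_⟩
  · simp only [tensor, MonoidalCategory.tensorIso_hom, MonoidalCategory.tensorHom_comp_tensorHom,
      Iso.refl_hom, Category.id_comp, h₁]
  · simp only [tensor, MonoidalCategory.tensorIso_hom, MonoidalCategory.tensorHom_comp_tensorHom,
      Iso.refl_hom, Category.id_comp, h₂]

lemma cls_heq {X Y X' Y' : C.Obj} (hX : X = X') (hY : Y = Y') (s : RawSpan A X Y)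
    (t : RawSpan A X' Y') (h : s.apex = t.apex) (h₁ : HEq s.left t.left)
    (h₂ : HEq s.right t.right) : HEq (cls s) (cls t) := by
  subst hX hY
  obtain ⟨P, l, r, _, _⟩ := s
  obtain ⟨P', l', r', _, _⟩ := t
  dsimp at h
  subst h
  obtain rfl : l = l' := eq_of_heq h₁
  obtain rfl : r = r' := eq_of_heq h₂
  rfl

lemma cls_ofHom_congr {X Y : C.Obj} {f g : X ⟶ Y} (h : f = g) (hf : A.arrows f)
    (hg : A.arrows g) : cls (ofHom f hf) = cls (ofHom g hg) := by
  subst h; rfl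

lemma cls_ofHom_heq {X Y X' Y' : C.Obj} (hX : X = X') (hY : Y = Y') (f : X ⟶ Y)
    (g : X' ⟶ Y') (hf : A.arrows f) (hg : A.arrows g) (h : HEq f g) :
    HEq (cls (ofHom f hf)) (cls (ofHom g hg)) := by
  subst hX hY
  exact heq_of_eq (cls_ofHom_congr (eq_of_heq h) hf hg)

lemma eqToHom_mem (A : SubPROP C) {X Y : C.Obj} (h : X = Y) : A.arrows (eqToHom h) := by
  subst h; exact A.id_mem _

lemma reindexId_cls {X Y : C.Obj} (h : X = Y) :
    reindexId (Hom := fun (m n : C.Obj) => Class A m n)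
      (fun (n : C.Obj) => cls (ofHom (𝟙 n) (A.id_mem n))) h =
      cls (ofHom (eqToHom h) (eqToHom_mem A h)) := by
  subst h; rfl

lemma tensor_ofHom_ofHom {X Y X' Y' : C.Obj} (f : X ⟶ Y) (g : X' ⟶ Y') (hf : A.arrows f)
    (hg : A.arrows g) :
    (ofHom f hf).tensor (ofHom g hg) = ofHom (f ⊗ₘ g) (A.tensor_mem f g hf hg) := by
  simp [ofHom, tensor]

lemma tensor_ofOpHom_ofOpHom {X Y X' Y' : C.Obj} (f : Y ⟶ X) (g : Y' ⟶ X') (hf : A.arrows f)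
    (hg : A.arrows g) :
    (ofOpHom f hf).tensor (ofOpHom g hg) = ofOpHom (f ⊗ₘ g) (A.tensor_mem f g hf hg) := by
  simp [ofOpHom, tensor]

lemma cls_ofHom_of_iso {X Y : C.Obj} (f : X ≅ Y) (hf : A.arrows f.hom) (hf' : A.arrows f.inv) :
    cls (ofHom f.hom hf) = cls (ofOpHom f.inv hf') :=
  cls_eq_of_iso (s := ofHom f.hom hf) (t := ofOpHom f.inv hf') f (by simp [ofHom, ofOpHom])
    (by simp [ofHom, ofOpHom])

variable [HasPullbacks C.Obj] (hA : A.arrows.IsStableUnderBaseChange)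

lemma comp_rel_right {X Y Z : C.Obj} (s : RawSpan A X Y)
    {t t' : RawSpan A Y Z} (h : Rel t t') : Rel (s.comp hA t) (s.comp hA t') := by
  obtain ⟨e, h₁, h₂⟩ := h
  have h : IsPullback (pullback.fst s.right t.left) (pullback.snd s.right t.left ≫ e.hom)
      s.right t'.left :=
    (IsPullback.of_hasPullback s.right t.left).of_iso (Iso.refl _) (Iso.refl _) e (Iso.refl _)
      (by simp) (by simp) (by simp) (by simp [h₁])
  exact ⟨h.isoPullback, by simp [comp], by simp [comp, h₂]⟩

lemma comp_rel_left {X Y Z : C.Obj} {s s' : RawSpan A X Y} (t : RawSpan A Y Z) (h : Rel s s') :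
    Rel (s.comp hA t) (s'.comp hA t) := by
  obtain ⟨e, h₁, h₂⟩ := h
  have h : IsPullback (pullback.fst s.right t.left ≫ e.hom) (pullback.snd s.right t.left)
      s'.right t.left :=
    (IsPullback.of_hasPullback s.right t.left).of_iso (Iso.refl _) e (Iso.refl _) (Iso.refl _)
      (by simp) (by simp) (by simp [h₂]) (by simp)
  exact ⟨h.isoPullback, by simp [comp, h₁], by simp [comp]⟩

lemma cls_comp_of_isPullback {X Y Z P : C.Obj} (s : RawSpan A X Y)
    (t : RawSpan A Y Z) {i : P ⟶ s.apex} {j : P ⟶ t.apex} (h : IsPullback i j s.right t.left)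
    (u : RawSpan A X Z) (e : u.apex ≅ P) (hl : u.left = e.hom ≫ i ≫ s.left)
    (hr : u.right = e.hom ≫ j ≫ t.right) : cls (s.comp hA t) = cls u :=
  cls_eq_of_iso (s := s.comp hA t) (t := u) (h.isoPullback.symm ≪≫ e.symm)
    (by simp [comp, hl]) (by simp [comp, hr])

lemma cls_comp_ofHom {X Y Z : C.Obj} (s : RawSpan A X Y) (f : Y ⟶ Z) (hf : A.arrows f) :
    cls (s.comp hA (ofHom f hf)) =
      cls ⟨s.apex, s.left, s.right ≫ f, s.left_mem, A.comp_mem _ _ s.right_mem hf⟩ :=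
  cls_comp_of_isPullback hA s (ofHom f hf) (i := 𝟙 _) (j := s.right) IsPullback.of_id_fst _
    (Iso.refl _)
    (by simp) (by simp [ofHom])

lemma cls_ofOpHom_comp {X Y Z : C.Obj} (f : Y ⟶ X) (hf : A.arrows f) (s : RawSpan A Y Z) :
    cls ((ofOpHom f hf).comp hA s) =
      cls ⟨s.apex, s.left ≫ f, s.right, A.comp_mem _ _ s.left_mem hf, s.right_mem⟩ :=
  cls_comp_of_isPullback hA (ofOpHom f hf) s (i := s.left) (j := 𝟙 _) IsPullback.of_id_snd _
    (Iso.refl _)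
    (by simp [ofOpHom]) (by simp)

lemma cls_comp_assoc {X Y Z T : C.Obj} (s : RawSpan A X Y) (t : RawSpan A Y Z)
    (u : RawSpan A Z T) : cls ((s.comp hA t).comp hA u) = cls (s.comp hA (t.comp hA u)) := by
  have h₁ := IsPullback.of_hasPullback s.right t.left
  have h₂ := IsPullback.of_hasPullback t.right u.left
  have h₃ := IsPullback.of_hasPullback (pullback.snd s.right t.left) (pullback.fst t.right u.left)
  have h₄ : IsPullback (pullback.fst (pullback.snd s.right t.left) (pullback.fst t.right u.left))
      (pullback.snd (pullback.snd s.right t.left) (pullback.fst t.right u.left) ≫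
        pullback.snd t.right u.left) (s.comp hA t).right u.left :=
    (h₃.flip.paste_horiz h₂.flip).flip
  have h₅ : IsPullback (pullback.fst (pullback.snd s.right t.left) (pullback.fst t.right u.left) ≫
        pullback.fst s.right t.left)
      (pullback.snd (pullback.snd s.right t.left) (pullback.fst t.right u.left))
      s.right (t.comp hA u).left :=
    (h₃.flip.paste_vert h₁.flip).flip
  let w : RawSpan A X T :=
    ⟨_, _ ≫ s.left, _ ≫ u.right,
      A.comp_mem _ _ (A.arrows.of_isPullback h₅.flip (t.comp hA u).left_mem) s.left_mem,
      A.comp_mem _ _ (A.arrows.of_isPullback h₄ (s.comp hA t).right_mem) u.right_mem⟩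
  rw [cls_comp_of_isPullback hA (s.comp hA t) u h₄ w (Iso.refl _) (by simp [comp, w])
      (by simp [w]),
    cls_comp_of_isPullback hA s (t.comp hA u) h₅ w (Iso.refl _) (by simp [w])
      (by simp [comp, w])]

/-- Composition of isomorphism classes of spans. -/
noncomputable def Class.comp {X Y Z : C.Obj} : Class A X Y → Class A Y Z → Class A X Z :=
  Quot.map₂ (RawSpan.comp hA) (fun s _ _ h => comp_rel_right hA s h)
    (fun _ _ t h => comp_rel_left hA t h)

/-- Monoidal product of isomorphism classes of spans. -/
def Class.tensor {X Y X' Y' : C.Obj} : Class A X Y → Class A X' Y' → Class A (X ⊗ X') (Y ⊗ Y') :=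
  Quot.map₂ RawSpan.tensor (fun s _ _ h => tensor_rel_right s h)
    (fun _ _ t h => tensor_rel_left t h)

lemma comp_ofHom_ofHom {X Y Z : C.Obj} (f : X ⟶ Y) (g : Y ⟶ Z) (hf : A.arrows f)
    (hg : A.arrows g) :
    Class.comp hA (cls (ofHom f hf)) (cls (ofHom g hg)) =
      cls (ofHom (f ≫ g) (A.comp_mem _ _ hf hg)) :=
  cls_comp_ofHom hA (ofHom f hf) g hg

lemma comp_ofOpHom_ofOpHom {X Y Z : C.Obj} (f : Y ⟶ X) (g : Z ⟶ Y) (hf : A.arrows f)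
    (hg : A.arrows g) :
    Class.comp hA (cls (ofOpHom f hf)) (cls (ofOpHom g hg)) =
      cls (ofOpHom (g ≫ f) (A.comp_mem _ _ hg hf)) :=
  cls_ofOpHom_comp hA f hf (ofOpHom g hg)

lemma id_comp {X Y : C.Obj} (s : RawSpan A X Y) :
    cls ((ofHom (𝟙 X) (A.id_mem X)).comp hA s) = cls s := by
  refine (cls_ofOpHom_comp hA (𝟙 X) (A.id_mem X) s).trans ?_
  simp only [Category.comp_id]

lemma comp_id {X Y : C.Obj} (s : RawSpan A X Y) :
    cls (s.comp hA (ofHom (𝟙 Y) (A.id_mem Y))) = cls s := by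
  rw [cls_comp_ofHom]
  simp only [Category.comp_id]

lemma comp_tensor (hT : TensorPreservesPullbacks A.arrows)
    {X Y Z X' Y' Z' : C.Obj} (s : RawSpan A X Y) (t : RawSpan A Y Z) (s' : RawSpan A X' Y')
    (t' : RawSpan A Y' Z') :
    cls ((s.comp hA t).tensor (s'.comp hA t')) = cls ((s.tensor s').comp hA (t.tensor t')) := by
  refine (cls_comp_of_isPullback hA (s.tensor s') (t.tensor t')
    (hT _ _ _ _ _ _ _ _ s.right_mem t.left_mem s'.right_mem t'.left_mem
      (IsPullback.of_hasPullback s.right t.left)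
      (IsPullback.of_hasPullback s'.right t'.left)) _ (Iso.refl _) ?_ ?_).symm
  · simp [comp, tensor]
  · simp [comp, tensor]

lemma comp_swap {X Y X' Y' : C.Obj} (s : RawSpan A X Y) (t : RawSpan A X' Y') :
    Class.comp hA (cls (s.tensor t)) (cls (ofHom (β_ Y Y').hom (A.swap_mem Y Y'))) =
      Class.comp hA (cls (ofHom (β_ X X').hom (A.swap_mem X X'))) (cls (t.tensor s)) := by
  have e : (β_ X X').inv = (β_ X' X).hom :=
    (SymmetricCategory.braiding_swap_eq_inv_braiding X X').symm
  have h : A.arrows (β_ X X').inv := e ▸ A.swap_mem X' X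
  rw [cls_ofHom_of_iso (β_ X X') (A.swap_mem X X') h]
  refine (cls_comp_ofHom hA (s.tensor t) _ _).trans ?_
  refine Eq.trans ?_ (cls_ofOpHom_comp hA _ h (t.tensor s)).symm
  refine cls_eq_of_iso (β_ s.apex t.apex) ?_ ?_
  · simp [tensor]
  · simp [tensor]

lemma swap_add (X Y Z : C.Obj) :
    HEq (cls (ofHom (β_ X (Y ⊗ Z)).hom (A.swap_mem X (Y ⊗ Z))))
      (Class.comp hA (Class.comp hA
        (Class.tensor (cls (ofHom (β_ X Y).hom (A.swap_mem X Y))) (cls (ofHom (𝟙 Z) (A.id_mem Z))))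
        (cls (ofHom (eqToHom (C.tensor_assoc_obj Y X Z)) (eqToHom_mem A _))))
        (Class.tensor (cls (ofHom (𝟙 Y) (A.id_mem Y)))
          (cls (ofHom (β_ X Z).hom (A.swap_mem X Z))))) := by
  have h : ∀ {X Y X' Y' : C.Obj} (f : X ⟶ Y) (g : X' ⟶ Y') (hf : A.arrows f) (hg : A.arrows g),
      Class.tensor (cls (ofHom f hf)) (cls (ofHom g hg)) =
        cls (ofHom (f ⊗ₘ g) (A.tensor_mem f g hf hg)) :=
    fun f g hf hg => congrArg cls (tensor_ofHom_ofHom f g hf hg)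
  rw [h, h, comp_ofHom_ofHom, comp_ofHom_ofHom]
  refine cls_ofHom_heq (C.tensor_assoc_obj X Y Z).symm (C.tensor_assoc_obj Y Z X) _ _ _ _
    ((C.swap_add X Y Z).trans (heq_of_eq ?_))
  rw [← C.reindexId_eq]
  rfl

end RawSpan

/-- The prop of isomorphism classes of spans in `C` with legs in the sub-prop `A`, composed by
pullback in `C`. -/
noncomputable def Span {C : PROP.{v}} [HasPullbacks C.Obj] (A : SubPROP C)
    (hA : A.arrows.IsStableUnderBaseChange) (hT : TensorPreservesPullbacks A.arrows) :
    PROP.{v} where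
  Hom := fun (m n : C.Obj) => RawSpan.Class A m n
  id := fun (n : C.Obj) => RawSpan.cls (RawSpan.ofHom (𝟙 n) (A.id_mem n))
  comp := RawSpan.Class.comp hA
  tensor := RawSpan.Class.tensor
  swap := fun (m n : C.Obj) => RawSpan.cls (RawSpan.ofHom (β_ m n).hom (A.swap_mem m n))
  id_comp := by
    rintro m n ⟨s⟩
    exact RawSpan.id_comp hA s
  comp_id := by
    rintro m n ⟨s⟩
    exact RawSpan.comp_id hA s
  assoc := by
    rintro k l m n ⟨s⟩ ⟨t⟩ ⟨u⟩
    exact RawSpan.cls_comp_assoc hA s t u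
  tensor_id := fun (m n : C.Obj) =>
    (congrArg RawSpan.cls (RawSpan.tensor_ofHom_ofHom (𝟙 m) (𝟙 n) (A.id_mem m) (A.id_mem n))).trans
      (RawSpan.cls_ofHom_congr (MonoidalCategory.id_tensorHom_id m n) _ _)
  tensor_comp := by
    rintro l m n l' m' n' ⟨s⟩ ⟨t⟩ ⟨s'⟩ ⟨t'⟩
    exact RawSpan.comp_tensor hA hT s t s' t'
  tensor_assoc := by
    rintro m n m' n' m'' n'' ⟨s⟩ ⟨t⟩ ⟨u⟩
    exact RawSpan.cls_heq (C.tensor_assoc_obj _ _ _) (C.tensor_assoc_obj _ _ _)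
      ((s.tensor t).tensor u) (s.tensor (t.tensor u)) (C.tensor_assoc_obj _ _ _)
      (C.tensor_assoc _ _ _) (C.tensor_assoc _ _ _)
  unit_tensor := by
    rintro m n ⟨s⟩
    exact RawSpan.cls_heq (C.unit_tensor_obj _) (C.unit_tensor_obj _)
      ((RawSpan.ofHom (𝟙 (𝟙_ C.Obj)) (A.id_mem _)).tensor s) s
      (C.unit_tensor_obj _) (C.unit_tensor _) (C.unit_tensor _)
  tensor_unit := by
    rintro m n ⟨s⟩
    exact RawSpan.cls_heq (C.tensor_unit_obj _) (C.tensor_unit_obj _)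
      (s.tensor (RawSpan.ofHom (𝟙 (𝟙_ C.Obj)) (A.id_mem _))) s
      (C.tensor_unit_obj _) (C.tensor_unit _) (C.tensor_unit _)
  swap_natural := by
    rintro m n m' n' ⟨s⟩ ⟨t⟩
    exact RawSpan.comp_swap hA s t
  swap_swap := fun (m n : C.Obj) =>
    (RawSpan.comp_ofHom_ofHom hA (β_ m n).hom (β_ n m).hom _ _).trans
      (RawSpan.cls_ofHom_congr (SymmetricCategory.symmetry m n) _ _)
  swap_add m n k := by
    rw [RawSpan.reindexId_cls (C.tensor_assoc_obj n m k)]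
    exact RawSpan.swap_add hA m n k


/-- The prop of isomorphism classes of cospans in `C`, composed by pushout: cospans modulo the
relation of having an isomorphism between their apexes that commutes with the legs. -/
noncomputable def Cospan (C : PROP.{v}) [HasPushouts C.Obj] (hC : TensorPreservesPushouts C) :
    PROP.{v} :=
  RawCospan.prop C hC (MorphismProperty.isomorphisms C.Obj) RawCospan.admissible_isomorphisms

lemma RawCospan.admissible_right {C : PROP.{v}} {E M : MorphismProperty C.Obj}
    (hEM : IsCostableFactorisationSystem E M) (hM : TensorClosed M) : RawCospan.Admissible M :=
  ⟨hEM.right_isMultiplicative, hEM.right_isStableUnderCobaseChange, hM⟩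

/-- The prop of corelations in `C` with respect to a costable factorisation system `(E, M)`: its
arrows are cospans in `C` modulo the equivalence relation generated by relating two cospans when
an arrow of `M` between their apexes commutes with the legs. -/
noncomputable def Corel (C : PROP.{v}) [HasPushouts C.Obj] (hC : TensorPreservesPushouts C)
    {E M : MorphismProperty C.Obj} (hEM : IsCostableFactorisationSystem E M)
    (hM : TensorClosed M) : PROP.{v} :=
  RawCospan.prop C hC M (RawCospan.admissible_right hEM hM)

/-- For every cospan `X ⟶ Z ⟵ Y` in `A`, the canonical map to `Z` from the pushout of its pullback
lies in `M`. -/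
def PushoutOfPullbackMem {C : PROP.{v}} [HasPushouts C.Obj] [HasPullbacks C.Obj]
    (A M : MorphismProperty C.Obj) : Prop :=
  ∀ ⦃X Y Z : C.Obj⦄ (f : X ⟶ Z) (g : Y ⟶ Z), A f → A g →
    M (pushout.desc f g pullback.condition :
      pushout (pullback.fst f g) (pullback.snd f g) ⟶ Z)

section Functors

variable {C : PROP.{v}} [HasPushouts C.Obj] (hC : TensorPreservesPushouts C)

/-- The morphism `A ⟶ Cospan C` sending `f` to the cospan with legs `f` and the identity. -/
noncomputable def toCospan (A : SubPROP C) : A.toPROP ⟶ Cospan C hC where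
  map f := RawCospan.cls _ (RawCospan.ofHom f.1)
  map_id _ := rfl
  map_comp f g := (RawCospan.comp_ofHom_ofHom RawCospan.admissible_isomorphisms f.1 g.1).symm
  map_tensor f g := (RawCospan.tensor_ofHom_ofHom RawCospan.admissible_isomorphisms f.1 g.1).symm
  map_swap _ _ := rfl

/-- The morphism `Aᵒᵖ ⟶ Cospan C` sending `g` to the cospan with legs the identity and `g`. -/
noncomputable def opToCospan (A : SubPROP C) : A.toPROP.op ⟶ Cospan C hC where
  map g := RawCospan.cls _ (RawCospan.ofOpHom g.1)
  map_id _ := rfl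
  map_comp f g := (RawCospan.comp_ofOpHom_ofOpHom RawCospan.admissible_isomorphisms f.1 g.1).symm
  map_tensor f g :=
    (RawCospan.tensor_ofOpHom_ofOpHom RawCospan.admissible_isomorphisms f.1 g.1).symm
  map_swap := fun (m n : C.Obj) => by
    have h := RawCospan.cls_ofHom_of_iso RawCospan.admissible_isomorphisms (β_ m n)
    rw [← SymmetricCategory.braiding_swap_eq_inv_braiding] at h
    exact h.symm

section

variable [HasPullbacks C.Obj] {A : SubPROP C} (hA : A.arrows.IsStableUnderBaseChange)
  (hT : TensorPreservesPullbacks A.arrows)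

/-- The morphism `A ⟶ Span A` sending `f` to the span with legs the identity and `f`. -/
noncomputable def toSpan : A.toPROP ⟶ Span A hA hT where
  map f := RawSpan.cls (RawSpan.ofHom f.1 f.2)
  map_id _ := rfl
  map_comp f g := (RawSpan.comp_ofHom_ofHom hA f.1 g.1 f.2 g.2).symm
  map_tensor f g := (congrArg RawSpan.cls (RawSpan.tensor_ofHom_ofHom f.1 g.1 f.2 g.2)).symm
  map_swap _ _ := rfl

/-- The morphism `Aᵒᵖ ⟶ Span A` sending `g` to the span with legs `g` and the identity. -/
noncomputable def opToSpan : A.toPROP.op ⟶ Span A hA hT where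
  map g := RawSpan.cls (RawSpan.ofOpHom g.1 g.2)
  map_id _ := rfl
  map_comp f g := (RawSpan.comp_ofOpHom_ofOpHom hA f.1 g.1 f.2 g.2).symm
  map_tensor f g := (congrArg RawSpan.cls (RawSpan.tensor_ofOpHom_ofOpHom f.1 g.1 f.2 g.2)).symm
  map_swap := fun (m n : C.Obj) => by
    have e : (β_ m n).inv = (β_ n m).hom :=
      (SymmetricCategory.braiding_swap_eq_inv_braiding m n).symm
    have h : A.arrows (β_ m n).inv := e ▸ A.swap_mem n m
    have h' := RawSpan.cls_ofHom_of_iso (β_ m n) (A.swap_mem m n) h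
    simp only [e] at h'
    exact h'.symm

end

variable {E M : MorphismProperty C.Obj} (hEM : IsCostableFactorisationSystem E M)
  (hM : TensorClosed M)

/-- The morphism `Γ : Cospan C ⟶ Corel C` sending the isomorphism class of a cospan to the
corelation that it represents. -/
noncomputable def Γ : Cospan C hC ⟶ Corel C hC hEM hM where
  map := Quot.map (fun s => s) fun _ _ ⟨w, hw, h₁, h₂⟩ =>
    ⟨w, hEM.right_of_isIso w ((MorphismProperty.isomorphisms.iff _).1 hw), h₁, h₂⟩
  map_id _ := rfl
  map_comp := by
    rintro l m n ⟨s⟩ ⟨t⟩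
    rfl
  map_tensor := by
    rintro m n m' n' ⟨s⟩ ⟨t⟩
    rfl
  map_swap _ _ := rfl

namespace RawSpan

variable {A : SubPROP C}

/-- The pushout of a span, as a cospan. -/
noncomputable def pushoutCospan {X Y : C.Obj} (s : RawSpan A X Y) : RawCospan X Y :=
  ⟨pushout s.left s.right, pushout.inl _ _, pushout.inr _ _⟩

variable {W : MorphismProperty C.Obj}

lemma cls_pushoutCospan (hW : RawCospan.Admissible W) {X Y P : C.Obj} (s : RawSpan A X Y) {i : X ⟶ P} {j : Y ⟶ P}
    (h : IsPushout s.left s.right i j) :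
    RawCospan.cls W s.pushoutCospan = RawCospan.cls W ⟨P, i, j⟩ :=
  RawCospan.cls_eq_of_iso hW (s := s.pushoutCospan) (t := ⟨P, i, j⟩) h.isoPushout.symm
    (by simp [pushoutCospan]) (by simp [pushoutCospan])

lemma pushoutCospan_rel (hW : RawCospan.Admissible W) {X Y : C.Obj} {s t : RawSpan A X Y} (h : Rel s t) :
    RawCospan.cls W s.pushoutCospan = RawCospan.cls W t.pushoutCospan := by
  obtain ⟨e, h₁, h₂⟩ := h
  refine cls_pushoutCospan hW s (P := pushout t.left t.right) (i := pushout.inl _ _)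
    (j := pushout.inr _ _) ?_
  exact (IsPushout.of_hasPushout t.left t.right).of_iso e.symm (Iso.refl _) (Iso.refl _)
    (Iso.refl _) (by simp [← h₁]) (by simp [← h₂]) (by simp) (by simp)

lemma pushoutCospan_eq_comp (hW : RawCospan.Admissible W) {X Y : C.Obj} (s : RawSpan A X Y) :
    RawCospan.cls W s.pushoutCospan = RawCospan.Class.comp hW
      (RawCospan.cls W (RawCospan.ofOpHom s.left)) (RawCospan.cls W (RawCospan.ofHom s.right)) := by
  refine congrArg (RawCospan.cls W) ?_
  simp [pushoutCospan, RawCospan.comp, RawCospan.ofOpHom, RawCospan.ofHom]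

lemma pushoutCospan_comp (hW : RawCospan.Admissible W) [HasPullbacks C.Obj] (hA : A.arrows.IsStableUnderBaseChange)
    (hAW : PushoutOfPullbackMem A.arrows W) {X Y Z : C.Obj} (s : RawSpan A X Y)
    (t : RawSpan A Y Z) :
    RawCospan.cls W (s.comp hA t).pushoutCospan =
      RawCospan.cls W (s.pushoutCospan.comp t.pushoutCospan) := by
  have assoc : ∀ {X Y Z T : C.Obj} (a : RawCospan.Class W X Y) (b : RawCospan.Class W Y Z)
      (c : RawCospan.Class W Z T), RawCospan.Class.comp hW (RawCospan.Class.comp hW a b) c =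
        RawCospan.Class.comp hW a (RawCospan.Class.comp hW b c) := by
    rintro X Y Z T ⟨a⟩ ⟨b⟩ ⟨c⟩
    exact RawCospan.cls_comp_assoc hW a b c
  have key : RawCospan.Class.comp hW (RawCospan.cls W (RawCospan.ofHom s.right))
      (RawCospan.cls W (RawCospan.ofOpHom t.left)) =
      RawCospan.Class.comp hW
        (RawCospan.cls W (RawCospan.ofOpHom (pullback.fst s.right t.left)))
        (RawCospan.cls W (RawCospan.ofHom (pullback.snd s.right t.left))) := by
    refine (RawCospan.cls_ofHom_comp hW s.right (RawCospan.ofOpHom t.left)).trans ?_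
    refine (Quot.sound ⟨_, hAW s.right t.left s.right_mem t.left_mem, ?_, ?_⟩).symm
    · simp only [RawCospan.comp, RawCospan.ofHom, RawCospan.ofOpHom, Category.id_comp,
        Category.comp_id]
      exact pushout.inl_desc _ _ _
    · simp only [RawCospan.comp, RawCospan.ofHom, RawCospan.ofOpHom, Category.id_comp]
      exact pushout.inr_desc _ _ _
  refine (pushoutCospan_eq_comp hW _).trans (Eq.symm ?_)
  refine (congrArg₂ (RawCospan.Class.comp hW) (pushoutCospan_eq_comp hW s)
    (pushoutCospan_eq_comp hW t)).trans ?_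
  rw [assoc, ← assoc (RawCospan.cls W (RawCospan.ofHom s.right)), key, assoc,
    RawCospan.comp_ofHom_ofHom, ← assoc, RawCospan.comp_ofOpHom_ofOpHom]
  rfl

end RawSpan

/-- The morphism `Π : Span A ⟶ Corel C` sending a span to the corelation represented by its
pushout. -/
noncomputable def Pi [HasPullbacks C.Obj] {A : SubPROP C}
    (hA : A.arrows.IsStableUnderBaseChange) (hT : TensorPreservesPullbacks A.arrows)
    (hAM : PushoutOfPullbackMem A.arrows M) : Span A hA hT ⟶ Corel C hC hEM hM where
  map := Quot.lift (fun s => RawCospan.cls M s.pushoutCospan)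
    fun _ _ h => RawSpan.pushoutCospan_rel (RawCospan.admissible_right hEM hM) h
  map_id := fun (n : C.Obj) =>
    RawSpan.cls_pushoutCospan (RawCospan.admissible_right hEM hM)
      (RawSpan.ofHom (𝟙 n) (A.id_mem n)) (i := 𝟙 n) (j := 𝟙 n) IsPushout.of_id_fst
  map_comp := by
    rintro l m n ⟨s⟩ ⟨t⟩
    exact RawSpan.pushoutCospan_comp (RawCospan.admissible_right hEM hM) hA hAM s t
  map_tensor := by
    rintro m n m' n' ⟨s⟩ ⟨t⟩
    exact RawSpan.cls_pushoutCospan (RawCospan.admissible_right hEM hM) (s.tensor t)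
      (hC _ _ _ _ _ _ _ _ (IsPushout.of_hasPushout s.left s.right)
        (IsPushout.of_hasPushout t.left t.right))
  map_swap := fun (m n : C.Obj) =>
    RawSpan.cls_pushoutCospan (RawCospan.admissible_right hEM hM)
      (RawSpan.ofHom (β_ m n).hom (A.swap_mem m n)) (i := (β_ m n).hom) (j := 𝟙 _)
      IsPushout.of_id_fst

end Functors

end PROP

namespace PROP

/-! Arrows of `Cospan C` and `Span A` split into one-legged pieces: a cospan is its left leg
followed by the opposite of its right leg, and a span is the opposite of its left leg followed by
its right leg. In a cospan the legs are arbitrary arrows of `C`, but in a span both lie in `A`. So a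
morphism `G` out of `Span A` is determined by its values on `A` and its opposite, and these are
exactly the arrows on which a cocone `(F, G)` over the square forces `G` to agree with `F`.

Corelations are cospans modulo `M`, so `F` factors through `Γ` once it identifies cospans related by
an arrow `m` of `M`. Such an `m` lies in `A` and is a monomorphism, so its kernel pair is trivial:
in `Span A`, `m` followed by its opposite is the identity. Applying `G` and using the agreement on
`A`, the image of `m` under `F`, followed by the image of its opposite, is an identity of `R`.
Extending both legs of a cospan by `m` inserts precisely this pair between the images of the legs,
so the value of `F` does not change (`map_eq_of_rel_mono`).

The factored morphism composed with `Π` is `G`: `F` at the pushout of a span and `G` at the span are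
composites of the same two images (`map_pushoutCospan`). Uniqueness holds because `Γ` is epi. The
square itself commutes because a span with an identity leg has an evident pushout. The condition on
pushouts of pullbacks enters earlier, in making `Π` preserve composition. -/

/-! ### Factoring through the quotient `Γ`. -/

/-- Descent of a morphism of props along `Γ`: a morphism out of the prop of cospans that identifies
cospans related by `M` factors through the prop of corelations. -/
noncomputable def descΓ {C : PROP.{v}} [HasPushouts C.Obj] (hC : TensorPreservesPushouts C)
    {E M : MorphismProperty C.Obj} (hEM : IsCostableFactorisationSystem E M) (hM : TensorClosed M)
    {R : PROP.{v}} (F : Cospan C hC ⟶ R)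
    (hF : ∀ {X Y : C.Obj} (s t : RawCospan X Y), RawCospan.Rel M s t →
      F.map (RawCospan.cls _ s) = F.map (RawCospan.cls _ t)) : Corel C hC hEM hM ⟶ R where
  -- `Quot` is formed from the generating relation itself, so invariance under single arrows of `M`
  -- suffices. The remaining fields reduce to those of `F` because both props compose and tensor
  -- representatives by the same formulas.
  map := Quot.lift (fun s => F.map (RawCospan.cls _ s)) hF
  map_id n := F.map_id n
  map_comp := by
    rintro l m n ⟨s⟩ ⟨t⟩
    exact F.map_comp (RawCospan.cls _ s) (RawCospan.cls _ t)
  map_tensor := by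
    rintro m n m' n' ⟨s⟩ ⟨t⟩
    exact F.map_tensor (RawCospan.cls _ s) (RawCospan.cls _ t)
  map_swap m n := F.map_swap m n

lemma Γ_comp_descΓ {C : PROP.{v}} [HasPushouts C.Obj] (hC : TensorPreservesPushouts C)
    {E M : MorphismProperty C.Obj} (hEM : IsCostableFactorisationSystem E M) (hM : TensorClosed M)
    {R : PROP.{v}} (F : Cospan C hC ⟶ R)
    (hF : ∀ {X Y : C.Obj} (s t : RawCospan X Y), RawCospan.Rel M s t →
      F.map (RawCospan.cls _ s) = F.map (RawCospan.cls _ t)) :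
    Γ hC hEM hM ≫ descΓ hC hEM hM F hF = F := by
  apply Morphism.ext
  funext m n f
  induction f using Quot.ind with | mk s => rfl

/-- Every corelation is represented by a cospan, so `Γ` is surjective on arrows. This gives the
uniqueness half of the universal property. -/
instance epi_Γ {C : PROP.{v}} [HasPushouts C.Obj] (hC : TensorPreservesPushouts C)
    {E M : MorphismProperty C.Obj} (hEM : IsCostableFactorisationSystem E M)
    (hM : TensorClosed M) : Epi (Γ hC hEM hM) where
  left_cancellation {R} H K h := by
    apply Morphism.ext
    funext m n f
    induction f using Quot.ind with | mk s => ?_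
    exact congrArg (fun T : Cospan C hC ⟶ R => T.map (RawCospan.cls _ s)) h

/-! ### Decomposing cospans and spans into their legs. -/

/-- The two legs that meet in the composite are identities, so the pushout changes nothing. -/
lemma RawCospan.cls_eq_comp {C : PROP.{v}} [HasPushouts C.Obj] {W : MorphismProperty C.Obj}
    (hW : RawCospan.Admissible W) {X Y : C.Obj} (s : RawCospan X Y) :
    RawCospan.cls W s =
      RawCospan.Class.comp hW (RawCospan.cls W (.ofHom s.left)) (RawCospan.cls W (.ofOpHom s.right)) := by
  refine Eq.trans ?_ (RawCospan.cls_ofHom_comp hW s.left (RawCospan.ofOpHom s.right)).symm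
  simp [RawCospan.ofOpHom]

/-- Dually, the pullback is taken over two identities. The opposite arrow now comes first, and both
factors come from `A`. -/
lemma RawSpan.cls_eq_comp {C : PROP.{v}} [HasPullbacks C.Obj] {A : SubPROP C}
    (hA : A.arrows.IsStableUnderBaseChange) {X Y : C.Obj} (s : RawSpan A X Y) :
    RawSpan.cls s = RawSpan.Class.comp hA (RawSpan.cls (.ofOpHom s.left s.left_mem))
      (RawSpan.cls (.ofHom s.right s.right_mem)) := by
  refine Eq.trans ?_ (RawSpan.cls_ofOpHom_comp hA s.left s.left_mem
    (RawSpan.ofHom s.right s.right_mem)).symm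
  simp [RawSpan.ofHom]

/-- In the prop of spans, a monomorphism followed by its opposite is the identity. -/
lemma RawSpan.comp_ofHom_ofOpHom_of_mono {C : PROP.{v}} [HasPullbacks C.Obj] {A : SubPROP C}
    (hA : A.arrows.IsStableUnderBaseChange) {X Y : C.Obj} (m : X ⟶ Y) [Mono m]
    (hm : A.arrows m) :
    RawSpan.Class.comp hA (RawSpan.cls (.ofHom m hm)) (RawSpan.cls (.ofOpHom m hm)) =
      RawSpan.cls (.ofHom (𝟙 X) (A.id_mem X)) :=
  -- The composite is the kernel pair of `m`, which for a monomorphism is a pair of identities.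
  RawSpan.cls_comp_of_isPullback hA (RawSpan.ofHom m hm) (RawSpan.ofOpHom m hm)
    (IsKernelPair.id_of_mono m) (RawSpan.ofHom (𝟙 X) (A.id_mem X)) (Iso.refl _)
    (by simp [RawSpan.ofHom]) (by simp [RawSpan.ofHom, RawSpan.ofOpHom])

/-- Used with `b` and `c` the images of an arrow `m` of `M` and of its opposite, and with `a` and
`d` the images of the two legs of a cospan. -/
lemma comp_eq_of_comp_eq_id (R : PROP.{v}) {k l m n : ℕ} (a : R.Hom k l) {b : R.Hom l m}
    {c : R.Hom m l} (d : R.Hom l n) (h : R.comp b c = R.id l) :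
    R.comp a d = R.comp (R.comp a b) (R.comp c d) := by
  rw [R.assoc, ← R.assoc b, h, R.id_comp]

/-- Functoriality phrased with `RawCospan.Class.comp`, the form in which the decomposition into legs
is stated; the two composites agree by unfolding `Cospan`. -/
lemma Cospan.map_classComp {C : PROP.{v}} [HasPushouts C.Obj] {hC : TensorPreservesPushouts C}
    {R : PROP.{v}} (F : Cospan C hC ⟶ R) {X Y Z : C.Obj} (s : RawCospan.Class _ X Y)
    (t : RawCospan.Class _ Y Z) :
    F.map (RawCospan.Class.comp RawCospan.admissible_isomorphisms s t) =
      R.comp (F.map s) (F.map t) :=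
  F.map_comp s t

lemma Span.map_classComp {C : PROP.{v}} [HasPullbacks C.Obj] {A : SubPROP C}
    {hA : A.arrows.IsStableUnderBaseChange} {hT : TensorPreservesPullbacks A.arrows}
    {R : PROP.{v}} (G : Span A hA hT ⟶ R) {X Y Z : C.Obj} (s : RawSpan.Class A X Y)
    (t : RawSpan.Class A Y Z) :
    G.map (RawSpan.Class.comp hA s t) = R.comp (G.map s) (G.map t) :=
  G.map_comp s t

/-! ### Consequences of agreement on `A` and on its opposite. -/

section Universal

variable {C : PROP.{v}} [HasPushouts C.Obj] [HasPullbacks C.Obj] {A : SubPROP C}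
  {hC : TensorPreservesPushouts C} {hA : A.arrows.IsStableUnderBaseChange}
  {hT : TensorPreservesPullbacks A.arrows} {R : PROP.{v}}
  {F : Cospan C hC ⟶ R} {G : Span A hA hT ⟶ R}

/-- If morphisms out of the props of cospans and of spans agree on `A` and on its opposite, the
first one identifies cospans that are related by monomorphisms of `A`. -/
lemma map_eq_of_rel_mono (h₁ : toCospan hC A ≫ F = toSpan hA hT ≫ G)
    (h₂ : opToCospan hC A ≫ F = opToSpan hA hT ≫ G) {M : MorphismProperty C.Obj}
    (hMono : M ≤ MorphismProperty.monomorphisms C.Obj) (hMA : M ≤ A.arrows)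
    {X Y : C.Obj} (s t : RawCospan X Y) (h : RawCospan.Rel M s t) :
    F.map (RawCospan.cls _ s) = F.map (RawCospan.cls _ t) := by
  obtain ⟨m, hm, hl, hr⟩ := h
  obtain ⟨N, l, r⟩ := s
  obtain ⟨N', l', r'⟩ := t
  dsimp at m hm hl hr
  -- From here the second cospan has legs `l ≫ m` and `r ≫ m`.
  subst hl hr
  have hmA : A.arrows m := hMA m hm
  have : Mono m := hMono m hm
  -- This cannot be derived in `Cospan C`, where the composite is the cospan with both legs `m`, an
  -- identity only if `m` is invertible. It is transported from `Span A` through `G`, which is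
  -- possible because `m` lies in `A`.
  have e : R.comp (F.map (RawCospan.cls _ (RawCospan.ofHom m)))
      (F.map (RawCospan.cls _ (RawCospan.ofOpHom m))) = R.id N := by
    have e₁ : F.map (RawCospan.cls _ (RawCospan.ofHom m)) =
        G.map (RawSpan.cls (RawSpan.ofHom m hmA)) :=
      congrArg (fun T : A.toPROP ⟶ R => T.map ⟨m, hmA⟩) h₁
    have e₂ : F.map (RawCospan.cls _ (RawCospan.ofOpHom m)) =
        G.map (RawSpan.cls (RawSpan.ofOpHom m hmA)) :=
      congrArg (fun T : A.toPROP.op ⟶ R => T.map ⟨m, hmA⟩) h₂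
    rw [e₁, e₂]
    refine (Span.map_classComp G _ _).symm.trans ?_
    exact (congrArg G.map (RawSpan.comp_ofHom_ofOpHom_of_mono hA m hmA)).trans (G.map_id N)
  have d : ∀ {X Y : C.Obj} (u : RawCospan X Y), F.map (RawCospan.cls _ u) =
      R.comp (F.map (RawCospan.cls _ (RawCospan.ofHom u.left)))
        (F.map (RawCospan.cls _ (RawCospan.ofOpHom u.right))) := fun u =>
    (congrArg F.map (RawCospan.cls_eq_comp RawCospan.admissible_isomorphisms u)).trans
      (Cospan.map_classComp F _ _)
  have dl : F.map (RawCospan.cls _ (RawCospan.ofHom (l ≫ m))) =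
      R.comp (F.map (RawCospan.cls _ (RawCospan.ofHom l)))
        (F.map (RawCospan.cls _ (RawCospan.ofHom m))) :=
    (congrArg F.map (RawCospan.comp_ofHom_ofHom RawCospan.admissible_isomorphisms l m).symm).trans
      (Cospan.map_classComp F _ _)
  -- Passing to opposites reverses the order, so the opposite of `m` comes first and lands next to
  -- the `m` at the end of `dl`.
  have dr : F.map (RawCospan.cls _ (RawCospan.ofOpHom (r ≫ m))) =
      R.comp (F.map (RawCospan.cls _ (RawCospan.ofOpHom m)))
        (F.map (RawCospan.cls _ (RawCospan.ofOpHom r))) :=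
    (congrArg F.map
      (RawCospan.comp_ofOpHom_ofOpHom RawCospan.admissible_isomorphisms m r).symm).trans
      (Cospan.map_classComp F _ _)
  refine (d ⟨N, l, r⟩).trans (Eq.trans ?_ (d ⟨N', l ≫ m, r ≫ m⟩).symm)
  refine Eq.trans ?_ (congrArg₂ R.comp dl dr).symm
  -- The adjacent images of `m` and its opposite cancel, leaving the images of `l` and of the
  -- opposite of `r`.
  exact R.comp_eq_of_comp_eq_id _ _ e

/-- If morphisms out of the props of cospans and of spans agree on `A` and on its opposite, the
value of the second at a span is the value of the first at its pushout. -/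
lemma map_pushoutCospan (h₁ : toCospan hC A ≫ F = toSpan hA hT ≫ G)
    (h₂ : opToCospan hC A ≫ F = opToSpan hA hT ≫ G) {X Y : C.Obj} (s : RawSpan A X Y) :
    F.map (RawCospan.cls _ s.pushoutCospan) = G.map (RawSpan.cls s) := by
  have e₁ : F.map (RawCospan.cls _ (RawCospan.ofHom s.right)) =
      G.map (RawSpan.cls (RawSpan.ofHom s.right s.right_mem)) :=
    congrArg (fun T : A.toPROP ⟶ R => T.map ⟨s.right, s.right_mem⟩) h₁
  have e₂ : F.map (RawCospan.cls _ (RawCospan.ofOpHom s.left)) =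
      G.map (RawSpan.cls (RawSpan.ofOpHom s.left s.left_mem)) :=
    congrArg (fun T : A.toPROP.op ⟶ R => T.map ⟨s.left, s.left_mem⟩) h₂
  -- The opposite of the left leg followed by the right leg composes by pushout to the pushout
  -- cospan in `Cospan C`, and by pullback over identities to `s` itself in `Span A`.
  refine (congrArg F.map (s.pushoutCospan_eq_comp RawCospan.admissible_isomorphisms)).trans ?_
  refine (Cospan.map_classComp F _ _).trans ?_
  rw [e₁, e₂]
  exact (Span.map_classComp G _ _).symm.trans (congrArg G.map (RawSpan.cls_eq_comp hA s)).symm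

/-! ### Commutativity of the square on generators. -/

variable {E M : MorphismProperty C.Obj} (hEM : IsCostableFactorisationSystem E M)
  (hM : TensorClosed M) (hAM : PushoutOfPullbackMem A.arrows M)

-- A pushout of the span with legs the identity and `f` is the cospan with legs `f` and the
-- identity, which is the cospan that represents `f` on the other side.
variable (hC hA hT) in
lemma toCospan_comp_Γ :
    toCospan hC A ≫ Γ hC hEM hM = toSpan hA hT ≫ Pi hC hEM hM hA hT hAM := by
  apply Morphism.ext
  funext m n f
  exact (RawSpan.cls_pushoutCospan (RawCospan.admissible_right hEM hM)
    (RawSpan.ofHom f.1 f.2) (i := f.1) (j := 𝟙 _) IsPushout.of_id_fst).symm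

-- The mirror image: here the identity is the right leg of the span, and the left leg of its
-- pushout.
variable (hC hA hT) in
lemma opToCospan_comp_Γ :
    opToCospan hC A ≫ Γ hC hEM hM = opToSpan hA hT ≫ Pi hC hEM hM hA hT hAM := by
  apply Morphism.ext
  funext m n f
  exact (RawSpan.cls_pushoutCospan (RawCospan.admissible_right hEM hM)
    (RawSpan.ofOpHom f.1 f.2) (i := 𝟙 _) (j := f.1) IsPushout.of_id_snd).symm

end Universal

end PROP

/-! ### The pushout square. -/

theorem mainTheorem6 (C : PROP.{v}) [HasPushouts C.Obj] [HasPullbacks C.Obj]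
    (E M : MorphismProperty C.Obj) (hEM : PROP.IsCostableFactorisationSystem E M)
    (hMono : M ≤ MorphismProperty.monomorphisms C.Obj)
    (A : PROP.SubPROP C) (hMA : M ≤ A.arrows) (hA : A.arrows.IsStableUnderBaseChange)
    (hAM : PROP.PushoutOfPullbackMem A.arrows M)
    (hC : PROP.TensorPreservesPushouts C) (hT : PROP.TensorPreservesPullbacks A.arrows)
    (hM : PROP.TensorClosed M) :
    IsPushout
      (coprod.desc (PROP.toCospan hC A) (PROP.opToCospan hC A) :
        A.toPROP ⨿ A.toPROP.op ⟶ PROP.Cospan C hC)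
      (coprod.desc (PROP.toSpan hA hT) (PROP.opToSpan hA hT) :
        A.toPROP ⨿ A.toPROP.op ⟶ PROP.Span A hA hT)
      (PROP.Γ hC hEM hM)
      (PROP.Pi hC hEM hM hA hT hAM) := by
  -- An equation out of the coproduct is a pair of equations, on `A` and on its opposite. One
  -- direction proves that the square commutes, the other unpacks the condition of an arbitrary
  -- cocone.
  have coprod_desc_comp_eq_iff : ∀ {P Q R : PROP.{v}} {f : A.toPROP ⟶ P} {f' : A.toPROP.op ⟶ P}
      {g : A.toPROP ⟶ Q} {g' : A.toPROP.op ⟶ Q} {F : P ⟶ R} {G : Q ⟶ R},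
      coprod.desc f f' ≫ F = coprod.desc g g' ≫ G ↔ f ≫ F = g ≫ G ∧ f' ≫ F = g' ≫ G := by
    intro P Q R f f' g g' F G
    refine ⟨fun h => ⟨?_, ?_⟩, fun h => ?_⟩
    · simpa only [coprod.inl_desc_assoc] using coprod.inl ≫= h
    · simpa only [coprod.inr_desc_assoc] using coprod.inr ≫= h
    · rw [coprod.desc_comp, coprod.desc_comp, h.1, h.2]
  refine ⟨⟨coprod_desc_comp_eq_iff.2 ⟨PROP.toCospan_comp_Γ hC hA hT hEM hM hAM,
    PROP.opToCospan_comp_Γ hC hA hT hEM hM hAM⟩⟩, ⟨PushoutCocone.IsColimit.mk _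
    (fun s => PROP.descΓ hC hEM hM s.inl (PROP.map_eq_of_rel_mono (G := s.inr)
      (coprod_desc_comp_eq_iff.1 s.condition).1 (coprod_desc_comp_eq_iff.1 s.condition).2 hMono hMA)) ?_ ?_ ?_⟩⟩
  · intro s
    exact PROP.Γ_comp_descΓ hC hEM hM s.inl _
  · intro s
    apply PROP.Morphism.ext
    funext m n f
    induction f using Quot.ind with | mk t => ?_
    -- On a representative `t`, `Π` followed by the descended morphism is by definition `s.inl` at
    -- the pushout cospan of `t`.
    exact PROP.map_pushoutCospan (coprod_desc_comp_eq_iff.1 s.condition).1 (coprod_desc_comp_eq_iff.1 s.condition).2 t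
  · intro s H h _
    -- The equation along `Γ` alone determines the morphism out of `Corel`.
    rw [← cancel_epi (PROP.Γ hC hEM hM), h, PROP.Γ_comp_descΓ]
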